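/- **Conventions.** A *PROP* is a small symmetric strict monoidal category $T$ whose monoid of objects is $(\mathbb N,+,0)$; its monoidal product is written $\oplus$, composition is written in diagrammatic order $f\,;\,g$, and $\mathrm{Ar}(T)$ is its set of arrows, a monoid under $\oplus$. A *morphism of PROPs* is an identity-on-objects strict symmetric monoidal functor. The PROP $P$ has as arrows $m\to n$ the bijections $\{0,\dots,m-1\}\to\{0,\dots,n-1\}$ (so there are none unless $m=n$), with composition of bijections, $\oplus$ the juxtaposition of bijections, and as symmetry $m\oplus n\to n\oplus m$ the exchange of the two blocks. A *monad* on an object $a$ of a bicategory is a 1-cell $t:a\to a$ with 2-cells $\eta:1_a\Rightarrow t$ and $\mu:t\,;\,t\Rightarrow t$ satisfying the unit and associativity laws. $\mathrm{Span}(\mathrm{Mon})$ is the bicategory of monoids, spans of monoids and span morphisms, with composition by pullback. For a bicategory $B$ whose hom-categories have reflexive coequalizers that are preserved by composition with 1-cells (as is the case for $\mathrm{Span}(\mathrm{Mon})$), $\mathrm{Mod}(B)$ is the bicategory whose objects are the monads in $B$, whose 1-cells $F\to G$ are the 1-cells $X$ of $B$ with a left action $F\,;\,X\Rightarrow X$ and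 a right action $X\,;\,G\Rightarrow X$, each unital and associative, that are compatible with each other, and whose 2-cells are the 2-cells of $B$ compatible with both actions. The composite of $X:F\to G$ and $Y:G\to H$ is the coequalizer of the two 2-cells $X\,;\,G\,;\,Y\Rightarrow X\,;\,Y$ given by the actions of $G$, and the identity of $F$ is $F$ with its multiplication as both actions. Every PROP $T$ is a monad in $\mathrm{Span}(\mathrm{Mon})$ on $(\mathbb N,+,0)$: its underlying span is $\mathbb N\xleftarrow{\mathrm{dom}}\mathrm{Ar}(T)\xrightarrow{\mathrm{cod}}\mathbb N$, its unit is $n\mapsto \mathrm{id}_n$, and its multiplication is composition. In particular $P$ is an object of $\mathrm{Mod}(\mathrm{Span}(\mathrm{Mon}))$. **Statement.** Let $T$ be a PROP. There is exactly one morphism of PROPs $\iota:P\to T$. The span $\mathbb N\leftarrow\mathrm{Ar}(T)\to\mathbb N$ of monoids carries the structure of a $P$-$P$-bimodule, hence of a 1-cell $P\to P$ in $\mathrm{Mod}(\mathrm{Span}(\mathrm{Mon}))$, with left action $(p,f)\mapsto \iota(p)\,;\,f$ and right action $(f,p)\mapsto f\,;\,\iota(p)$; and this 1-cell carries the structure of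 a monad on $P$ in $\mathrm{Mod}(\mathrm{Span}(\mathrm{Mon}))$ whose multiplication sends the class of a composable pair $(f,g)$ of arrows of $T$ to $f\,;\,g$ and whose unit sends a permutation $p$ to $\iota(p)$. -/

import Mathlib

namespace PropMonads

open CategoryTheory Bicategory Limits

universe w v u

section Bimodules

variable {B : Type u} [Bicategory.{w, v} B]

/-- A monad structure on a 1-cell `t : a ⟶ a` of a bicategory. -/
@[ext]
structure MonadOn {a : B} (t : a ⟶ a) where
  η : 𝟙 a ⟶ t
  μ : t ≫ t ⟶ t
  η_μ : η ▷ t ≫ μ = (λ_ t).hom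
  μ_η : t ◁ η ≫ μ = (ρ_ t).hom
  assoc : μ ▷ t ≫ μ = (α_ t t t).hom ≫ t ◁ μ ≫ μ

/-- Every hom-category has coequalizers of reflexive pairs, and horizontal composition with a
1-cell on either side preserves them. -/
class HasStableReflexiveCoequalizers (B : Type u) [Bicategory.{w, v} B] : Prop where
  hasReflexiveCoequalizers (a b : B) : HasReflexiveCoequalizers (a ⟶ b)
  precomp_preserves {a b : B} (c : B) (h : a ⟶ b) {X Y : b ⟶ c} (f g : X ⟶ Y)
    [IsReflexivePair f g] : PreservesColimit (parallelPair f g) (precomp c h)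
  postcomp_preserves (a : B) {b c : B} (h : b ⟶ c) {X Y : a ⟶ b} (f g : X ⟶ Y)
    [IsReflexivePair f g] : PreservesColimit (parallelPair f g) (postcomp a h)

/-- An object of the bicategory of bimodules in `B`: a monad in `B`. -/
structure ModCat (B : Type u) [Bicategory.{w, v} B] where
  base : B
  cell : base ⟶ base
  monad : MonadOn cell

/-- The structure of an `(F, G)`-bimodule on a 1-cell. -/
@[ext]
structure BimodStr (F G : ModCat B) (X : F.base ⟶ G.base) where
  l : F.cell ≫ X ⟶ X
  r : X ≫ G.cell ⟶ X
  unit_l : F.monad.η ▷ X ≫ l = (λ_ X).hom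
  mul_l : F.monad.μ ▷ X ≫ l = (α_ F.cell F.cell X).hom ≫ F.cell ◁ l ≫ l
  unit_r : X ◁ G.monad.η ≫ r = (ρ_ X).hom
  mul_r : X ◁ G.monad.μ ≫ r = (α_ X G.cell G.cell).inv ≫ r ▷ G.cell ≫ r
  middle : l ▷ G.cell ≫ r = (α_ F.cell X G.cell).hom ≫ F.cell ◁ r ≫ l

/-- A bimodule between two monads. -/
structure Bimod (F G : ModCat B) where
  X : F.base ⟶ G.base
  str : BimodStr F G X

namespace Bimod

abbrev l {F G : ModCat B} (M : Bimod F G) : F.cell ≫ M.X ⟶ M.X := M.str.l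
abbrev r {F G : ModCat B} (M : Bimod F G) : M.X ≫ G.cell ⟶ M.X := M.str.r

/-- A morphism of bimodules: a 2-cell compatible with both actions. -/
@[ext]
structure Hom {F G : ModCat B} (M N : Bimod F G) where
  hom : M.X ⟶ N.X
  l_hom : M.l ≫ hom = F.cell ◁ hom ≫ N.l
  r_hom : M.r ≫ hom = hom ▷ G.cell ≫ N.r

instance category (F G : ModCat B) : Category (Bimod F G) where
  Hom M N := Hom M N
  id M := { hom := 𝟙 M.X, l_hom := by simp, r_hom := by simp }
  comp f g :=
    { hom := f.hom ≫ g.hom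
      l_hom := by rw [← Category.assoc, f.l_hom, Category.assoc, g.l_hom]; simp
      r_hom := by rw [← Category.assoc, f.r_hom, Category.assoc, g.r_hom]; simp }

@[ext]
theorem hom_ext {F G : ModCat B} {M N : Bimod F G} (f g : M ⟶ N) (h : f.hom = g.hom) : f = g :=
  Hom.ext h

@[simp] theorem id_hom {F G : ModCat B} (M : Bimod F G) : Hom.hom (𝟙 M) = 𝟙 M.X := rfl

@[simp] theorem comp_hom {F G : ModCat B} {M N K : Bimod F G} (f : M ⟶ N) (g : N ⟶ K) :
    (f ≫ g).hom = f.hom ≫ g.hom := rfl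

/-- A bimodule isomorphism from an invertible 2-cell compatible with the actions. -/
@[simps]
def mkIso {F G : ModCat B} {M N : Bimod F G} (f : M ⟶ N) (g : N.X ⟶ M.X)
    (h₁ : f.hom ≫ g = 𝟙 _) (h₂ : g ≫ f.hom = 𝟙 _) : M ≅ N where
  hom := f
  inv :=
    { hom := g
      l_hom := by
        have e : F.cell ◁ g ≫ F.cell ◁ f.hom = 𝟙 _ := by rw [← whiskerLeft_comp, h₂]; simp
        calc N.l ≫ g = F.cell ◁ g ≫ (F.cell ◁ f.hom ≫ N.l) ≫ g := by
              rw [Category.assoc, ← Category.assoc, e, Category.id_comp]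
          _ = _ := by rw [← f.l_hom]; simp [h₁]
      r_hom := by
        have e : g ▷ G.cell ≫ f.hom ▷ G.cell = 𝟙 _ := by rw [← comp_whiskerRight, h₂]; simp
        calc N.r ≫ g = g ▷ G.cell ≫ (f.hom ▷ G.cell ≫ N.r) ≫ g := by
              rw [Category.assoc, ← Category.assoc, e, Category.id_comp]
          _ = _ := by rw [← f.r_hom]; simp [h₁] }
  hom_inv_id := by ext; exact h₁
  inv_hom_id := by ext; exact h₂

/-- The regular bimodule of a monad. -/
abbrev regular (F : ModCat B) : Bimod F F where
  X := F.cell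
  str :=
    { l := F.monad.μ
      r := F.monad.μ
      unit_l := F.monad.η_μ
      mul_l := F.monad.assoc
      unit_r := F.monad.μ_η
      mul_r := by rw [F.monad.assoc]; simp
      middle := F.monad.assoc }

section Tensor

variable {F G H K : ModCat B}

/-- The two 2-cells whose coequalizer is the composite of two bimodules. -/
abbrev act₁ (M : Bimod F G) (N : Bimod G H) : (M.X ≫ G.cell) ≫ N.X ⟶ M.X ≫ N.X :=
  M.r ▷ N.X
abbrev act₂ (M : Bimod F G) (N : Bimod G H) : (M.X ≫ G.cell) ≫ N.X ⟶ M.X ≫ N.X :=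
  (α_ M.X G.cell N.X).hom ≫ M.X ◁ N.l

instance (M : Bimod F G) (N : Bimod G H) : IsReflexivePair (act₁ M N) (act₂ M N) :=
  .mk' (((ρ_ M.X).inv ≫ M.X ◁ G.monad.η) ▷ N.X)
    (by rw [act₁, ← comp_whiskerRight, Category.assoc, M.str.unit_r]; simp)
    (by
      have := N.str.unit_l
      rw [act₂, comp_whiskerRight, Category.assoc, associator_naturality_middle_assoc,
        ← whiskerLeft_comp, this]
      simp)

variable [HasStableReflexiveCoequalizers B]

instance (M : Bimod F G) (N : Bimod G H) : HasCoequalizer (act₁ M N) (act₂ M N) :=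
  (HasStableReflexiveCoequalizers.hasReflexiveCoequalizers F.base H.base).has_coeq _ _

/-- The underlying 1-cell of the composite of two bimodules. -/
noncomputable def tX (M : Bimod F G) (N : Bimod G H) : F.base ⟶ H.base :=
  coequalizer (act₁ M N) (act₂ M N)

/-- The quotient 2-cell onto the composite of two bimodules. -/
noncomputable def π₀ (M : Bimod F G) (N : Bimod G H) : M.X ≫ N.X ⟶ tX M N :=
  coequalizer.π (act₁ M N) (act₂ M N)

theorem π₀_cond (M : Bimod F G) (N : Bimod G H) :
    M.r ▷ N.X ≫ π₀ M N = (α_ M.X G.cell N.X).hom ≫ M.X ◁ N.l ≫ π₀ M N := by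
  exact (coequalizer.condition (act₁ M N) (act₂ M N)).trans (Category.assoc _ _ _)

theorem π₀_cond_assoc (M : Bimod F G) (N : Bimod G H)
    {Z' : _} (h' : _ ⟶ Z') :
    M.r ▷ N.X ≫ π₀ M N ≫ h' =
      (α_ M.X G.cell N.X).hom ≫ M.X ◁ N.l ≫ π₀ M N ≫ h' := by
  simpa only [Category.assoc] using congrArg (· ≫ h') (π₀_cond M N)

noncomputable def isColimit (M : Bimod F G) (N : Bimod G H) :
    IsColimit (Cofork.ofπ (f := act₁ M N) (g := act₂ M N) (π₀ M N)
      (coequalizer.condition (act₁ M N) (act₂ M N))) :=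
  coequalizerIsCoequalizer _ _

instance {C D : Type*} [Category* C] [Category* D] (T : C ⥤ D) {X Y : C} (f g : X ⟶ Y)
    [IsReflexivePair f g] : IsReflexivePair (T.map f) (T.map g) :=
  .mk' (T.map (commonSection f g)) (by simp [← T.map_comp]) (by simp [← T.map_comp])

theorem preserves_pre {a : B} (L : a ⟶ F.base) (M : Bimod F G) (N : Bimod G H) :
    PreservesColimit (parallelPair (act₁ M N) (act₂ M N)) (precomp H.base L) :=
  HasStableReflexiveCoequalizers.precomp_preserves _ _ _ _

theorem preserves_post {b : B} (M : Bimod F G) (N : Bimod G H) (R : H.base ⟶ b) :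
    PreservesColimit (parallelPair (act₁ M N) (act₂ M N)) (postcomp F.base R) :=
  HasStableReflexiveCoequalizers.postcomp_preserves _ _ _ _

noncomputable def isColimitL {a : B} (L : a ⟶ F.base) (M : Bimod F G) (N : Bimod G H) :=
  haveI := preserves_pre L M N
  isColimitCoforkMapOfIsColimit (precomp H.base L) _ (isColimit M N)

noncomputable def isColimitR {b : B} (M : Bimod F G) (N : Bimod G H) (R : H.base ⟶ b) :=
  haveI := preserves_post M N R
  isColimitCoforkMapOfIsColimit (postcomp F.base R) _ (isColimit M N)

theorem preserves_pre_post {a b : B} (L : a ⟶ F.base) (M : Bimod F G) (N : Bimod G H)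
    (R : H.base ⟶ b) :
    PreservesColimit (parallelPair ((precomp H.base L).map (act₁ M N))
      ((precomp H.base L).map (act₂ M N))) (postcomp a R) :=
  HasStableReflexiveCoequalizers.postcomp_preserves _ _ _ _

theorem preserves_post_post {b c : B} (M : Bimod F G) (N : Bimod G H)
    (R : H.base ⟶ b) (S : b ⟶ c) :
    PreservesColimit (parallelPair ((postcomp F.base R).map (act₁ M N))
      ((postcomp F.base R).map (act₂ M N))) (postcomp F.base S) :=
  HasStableReflexiveCoequalizers.postcomp_preserves _ _ _ _

instance (M : Bimod F G) (N : Bimod G H) : Epi (π₀ M N) :=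
  inferInstanceAs (Epi (coequalizer.π _ _))

instance epiL {a : B} (L : a ⟶ F.base) (M : Bimod F G) (N : Bimod G H) : Epi (L ◁ π₀ M N) :=
  Cofork.IsColimit.epi (isColimitL L M N)

instance epiR {b : B} (M : Bimod F G) (N : Bimod G H) (R : H.base ⟶ b) : Epi (π₀ M N ▷ R) :=
  Cofork.IsColimit.epi (isColimitR M N R)

instance epiLR {a b : B} (L : a ⟶ F.base) (M : Bimod F G) (N : Bimod G H) (R : H.base ⟶ b) :
    Epi ((L ◁ π₀ M N) ▷ R) :=
  haveI := preserves_pre_post L M N R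
  Cofork.IsColimit.epi (isColimitCoforkMapOfIsColimit (postcomp a R) _ (isColimitL L M N))

instance epiLR' {a b : B} (L : a ⟶ F.base) (M : Bimod F G) (N : Bimod G H) (R : H.base ⟶ b) :
    Epi (L ◁ (π₀ M N ▷ R)) := by
  have : L ◁ (π₀ M N ▷ R) = (α_ _ _ _).inv ≫ (L ◁ π₀ M N) ▷ R ≫ (α_ _ _ _).hom := by simp
  rw [this]
  infer_instance

instance epiRR {b c : B} (M : Bimod F G) (N : Bimod G H) (R : H.base ⟶ b) (S : b ⟶ c) :
    Epi ((π₀ M N ▷ R) ▷ S) :=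
  haveI := preserves_post_post M N R S
  Cofork.IsColimit.epi (isColimitCoforkMapOfIsColimit (postcomp F.base S) _ (isColimitR M N R))

noncomputable def desc₀ (M : Bimod F G) (N : Bimod G H) {Z : F.base ⟶ H.base} (k : M.X ≫ N.X ⟶ Z)
    (w : M.r ▷ N.X ≫ k = (α_ M.X G.cell N.X).hom ≫ M.X ◁ N.l ≫ k) : tX M N ⟶ Z :=
  Cofork.IsColimit.desc (isColimit M N) k (by simpa using w)

@[simp] theorem π₀_desc (M : Bimod F G) (N : Bimod G H) {Z : F.base ⟶ H.base} (k : M.X ≫ N.X ⟶ Z)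
    (w : M.r ▷ N.X ≫ k = (α_ M.X G.cell N.X).hom ≫ M.X ◁ N.l ≫ k) :
    π₀ M N ≫ desc₀ M N k w = k :=
  Cofork.IsColimit.π_desc' (isColimit M N) k (by simpa using w)

@[simp] theorem π₀_desc_assoc (M : Bimod F G) (N : Bimod G H) {Z : F.base ⟶ H.base} (k : M.X ≫ N.X ⟶ Z) (w : M.r ▷ N.X ≫ k = (α_ M.X G.cell N.X).hom ≫ M.X ◁ N.l ≫ k)
    {Z' : _} (h' : _ ⟶ Z') :
    π₀ M N ≫ desc₀ M N k w ≫ h' =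
      k ≫ h' := by
  simpa only [Category.assoc] using congrArg (· ≫ h') (π₀_desc M N k w)

noncomputable def descL₀ {a : B} (L : a ⟶ F.base) (M : Bimod F G) (N : Bimod G H)
    {Z : a ⟶ H.base} (k : L ≫ M.X ≫ N.X ⟶ Z)
    (w : L ◁ (M.r ▷ N.X) ≫ k =
      L ◁ (α_ M.X G.cell N.X).hom ≫ L ◁ (M.X ◁ N.l) ≫ k) : L ≫ tX M N ⟶ Z :=
  Cofork.IsColimit.desc (isColimitL L M N) k (by simpa [precomp] using w)

@[simp] theorem π₀_descL {a : B} (L : a ⟶ F.base) (M : Bimod F G) (N : Bimod G H)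
    {Z : a ⟶ H.base} (k : L ≫ M.X ≫ N.X ⟶ Z)
    (w : L ◁ (M.r ▷ N.X) ≫ k =
      L ◁ (α_ M.X G.cell N.X).hom ≫ L ◁ (M.X ◁ N.l) ≫ k) :
    L ◁ π₀ M N ≫ descL₀ L M N k w = k :=
  Cofork.IsColimit.π_desc' (isColimitL L M N) k (by simpa [precomp] using w)

@[simp] theorem π₀_descL_assoc {a : B} (L : a ⟶ F.base) (M : Bimod F G) (N : Bimod G H) {Z : a ⟶ H.base} (k : L ≫ M.X ≫ N.X ⟶ Z) (w : L ◁ (M.r ▷ N.X) ≫ k =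
      L ◁ (α_ M.X G.cell N.X).hom ≫ L ◁ (M.X ◁ N.l) ≫ k)
    {Z' : _} (h' : _ ⟶ Z') :
    L ◁ π₀ M N ≫ descL₀ L M N k w ≫ h' =
      k ≫ h' := by
  simpa only [Category.assoc] using congrArg (· ≫ h') (π₀_descL L M N k w)

noncomputable def descR₀ {b : B} (M : Bimod F G) (N : Bimod G H) (R : H.base ⟶ b)
    {Z : F.base ⟶ b} (k : (M.X ≫ N.X) ≫ R ⟶ Z)
    (w : (M.r ▷ N.X) ▷ R ≫ k =
      (α_ M.X G.cell N.X).hom ▷ R ≫ (M.X ◁ N.l) ▷ R ≫ k) : tX M N ≫ R ⟶ Z :=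
  Cofork.IsColimit.desc (isColimitR M N R) k (by simpa [postcomp] using w)

@[simp] theorem π₀_descR {b : B} (M : Bimod F G) (N : Bimod G H) (R : H.base ⟶ b)
    {Z : F.base ⟶ b} (k : (M.X ≫ N.X) ≫ R ⟶ Z)
    (w : (M.r ▷ N.X) ▷ R ≫ k =
      (α_ M.X G.cell N.X).hom ▷ R ≫ (M.X ◁ N.l) ▷ R ≫ k) :
    π₀ M N ▷ R ≫ descR₀ M N R k w = k :=
  Cofork.IsColimit.π_desc' (isColimitR M N R) k (by simpa [postcomp] using w)

@[simp] theorem π₀_descR_assoc {b : B} (M : Bimod F G) (N : Bimod G H) (R : H.base ⟶ b) {Z : F.base ⟶ b} (k : (M.X ≫ N.X) ≫ R ⟶ Z) (w : (M.r ▷ N.X) ▷ R ≫ k =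
      (α_ M.X G.cell N.X).hom ▷ R ≫ (M.X ◁ N.l) ▷ R ≫ k)
    {Z' : _} (h' : _ ⟶ Z') :
    π₀ M N ▷ R ≫ descR₀ M N R k w ≫ h' =
      k ≫ h' := by
  simpa only [Category.assoc] using congrArg (· ≫ h') (π₀_descR M N R k w)

end Tensor
end Bimod
end Bimodules
end PropMonads

namespace PropMonads

open CategoryTheory Bicategory Limits

universe w v u

section Bimodules

variable {B : Type u} [Bicategory.{w, v} B] [HasStableReflexiveCoequalizers B]
namespace Bimod
variable {F G H K J : ModCat B}

noncomputable def tl (M : Bimod F G) (N : Bimod G H) : F.cell ≫ tX M N ⟶ tX M N :=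
  descL₀ F.cell M N ((α_ _ _ _).inv ≫ M.l ▷ N.X ≫ π₀ M N) (by
    have e := M.str.middle
    slice_lhs 1 2 => rw [associator_inv_naturality_middle]
    slice_lhs 2 3 => rw [← comp_whiskerRight]
    slice_rhs 2 3 => rw [associator_inv_naturality_right]
    slice_rhs 3 4 => rw [whisker_exchange]
    rw [show M.r = M.str.r from rfl, show M.l = M.str.l from rfl] at *
    have e' : F.cell ◁ M.str.r ≫ M.str.l =
      (α_ F.cell M.X G.cell).inv ≫ M.str.l ▷ G.cell ≫ M.str.r := by rw [e]; simp
    rw [e']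
    simp [π₀_cond])

@[simp] theorem π₀_tl (M : Bimod F G) (N : Bimod G H) :
    F.cell ◁ π₀ M N ≫ tl M N = (α_ _ _ _).inv ≫ M.l ▷ N.X ≫ π₀ M N :=
  π₀_descL _ _ _ _ _

@[simp] theorem π₀_tl_assoc (M : Bimod F G) (N : Bimod G H)
    {Z' : _} (h' : _ ⟶ Z') :
    F.cell ◁ π₀ M N ≫ tl M N ≫ h' =
      (α_ _ _ _).inv ≫ M.l ▷ N.X ≫ π₀ M N ≫ h' := by
  simpa only [Category.assoc] using congrArg (· ≫ h') (π₀_tl M N)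

noncomputable def tr (M : Bimod F G) (N : Bimod G H) : tX M N ≫ H.cell ⟶ tX M N :=
  descR₀ M N H.cell ((α_ _ _ _).hom ≫ M.X ◁ N.r ≫ π₀ M N) (by
    have e := N.str.middle
    slice_lhs 1 2 => rw [associator_naturality_left]
    slice_lhs 2 3 => rw [← whisker_exchange]
    slice_lhs 3 4 => rw [π₀_cond]
    simp only [whisker_assoc, Category.assoc, Iso.inv_hom_id_assoc]
    slice_rhs 3 4 => rw [← whiskerLeft_comp, e]
    simp)

@[simp] theorem π₀_tr (M : Bimod F G) (N : Bimod G H) :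
    π₀ M N ▷ H.cell ≫ tr M N = (α_ _ _ _).hom ≫ M.X ◁ N.r ≫ π₀ M N :=
  π₀_descR _ _ _ _ _

@[simp] theorem π₀_tr_assoc (M : Bimod F G) (N : Bimod G H)
    {Z' : _} (h' : _ ⟶ Z') :
    π₀ M N ▷ H.cell ≫ tr M N ≫ h' =
      (α_ _ _ _).hom ≫ M.X ◁ N.r ≫ π₀ M N ≫ h' := by
  simpa only [Category.assoc] using congrArg (· ≫ h') (π₀_tr M N)

noncomputable def tensor (M : Bimod F G) (N : Bimod G H) : Bimod F H where
  X := tX M N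
  str :=
    { l := tl M N
      r := tr M N
      unit_l := by
        rw [← cancel_epi (𝟙 _ ◁ π₀ M N)]
        slice_lhs 1 2 => rw [whisker_exchange]
        slice_lhs 2 3 => rw [π₀_tl]
        slice_lhs 1 2 => rw [associator_inv_naturality_left]
        slice_lhs 2 3 => rw [← comp_whiskerRight, M.str.unit_l]
        simp
      mul_l := by
        rw [← cancel_epi (_ ◁ π₀ M N)]
        slice_lhs 1 2 => rw [whisker_exchange]
        slice_lhs 2 3 => rw [π₀_tl]
        slice_lhs 1 2 => rw [associator_inv_naturality_left]
        slice_lhs 2 3 => rw [← comp_whiskerRight, M.str.mul_l, comp_whiskerRight, comp_whiskerRight]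
        slice_rhs 1 2 => rw [associator_naturality_right]
        slice_rhs 2 3 => rw [← whiskerLeft_comp, π₀_tl, whiskerLeft_comp, whiskerLeft_comp]
        slice_rhs 4 5 => rw [π₀_tl]
        slice_rhs 3 4 => rw [associator_inv_naturality_middle]
        simp
      unit_r := by
        rw [← cancel_epi (π₀ M N ▷ 𝟙 _)]
        slice_lhs 1 2 => rw [← whisker_exchange]
        slice_lhs 2 3 => rw [π₀_tr]
        slice_lhs 1 2 => rw [associator_naturality_right]
        slice_lhs 2 3 => rw [← whiskerLeft_comp, N.str.unit_r]
        simp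
      mul_r := by
        rw [← cancel_epi (π₀ M N ▷ _)]
        slice_lhs 1 2 => rw [← whisker_exchange]
        slice_lhs 2 3 => rw [π₀_tr]
        slice_lhs 1 2 => rw [associator_naturality_right]
        slice_lhs 2 3 => rw [← whiskerLeft_comp, N.str.mul_r, whiskerLeft_comp, whiskerLeft_comp]
        slice_rhs 1 2 => rw [associator_inv_naturality_left]
        slice_rhs 2 3 => rw [← comp_whiskerRight, π₀_tr, comp_whiskerRight, comp_whiskerRight]
        slice_rhs 4 5 => rw [π₀_tr]
        slice_rhs 3 4 => rw [associator_naturality_middle]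
        simp
      middle := by
        rw [← cancel_epi ((F.cell ◁ π₀ M N) ▷ H.cell)]
        slice_lhs 1 2 => rw [← comp_whiskerRight, π₀_tl, comp_whiskerRight, comp_whiskerRight]
        slice_lhs 3 4 => rw [π₀_tr]
        slice_lhs 2 3 => rw [associator_naturality_left]
        slice_rhs 1 2 => rw [associator_naturality_middle]
        slice_rhs 2 3 => rw [← whiskerLeft_comp, π₀_tr, whiskerLeft_comp, whiskerLeft_comp]
        slice_rhs 4 5 => rw [π₀_tl]
        slice_rhs 3 4 => rw [associator_inv_naturality_right]
        slice_rhs 4 5 => rw [whisker_exchange]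
        simp }

/-- The quotient 2-cell onto the composite of two bimodules. -/
noncomputable def π (M : Bimod F G) (N : Bimod G H) : M.X ≫ N.X ⟶ (tensor M N).X :=
  π₀ M N

theorem π_cond (M : Bimod F G) (N : Bimod G H) :
    M.r ▷ N.X ≫ π M N = (α_ M.X G.cell N.X).hom ≫ M.X ◁ N.l ≫ π M N :=
  π₀_cond M N

theorem π_cond_assoc (M : Bimod F G) (N : Bimod G H)
    {Z' : _} (h' : _ ⟶ Z') :
    M.r ▷ N.X ≫ π M N ≫ h' =
      (α_ M.X G.cell N.X).hom ≫ M.X ◁ N.l ≫ π M N ≫ h' := by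
  simpa only [Category.assoc] using congrArg (· ≫ h') (π_cond M N)

instance (M : Bimod F G) (N : Bimod G H) : Epi (π M N) :=
  inferInstanceAs (Epi (π₀ M N))

instance {a : B} (L : a ⟶ F.base) (M : Bimod F G) (N : Bimod G H) : Epi (L ◁ π M N) :=
  epiL L M N

instance {b : B} (M : Bimod F G) (N : Bimod G H) (R : H.base ⟶ b) : Epi (π M N ▷ R) :=
  epiR M N R

instance {a b : B} (L : a ⟶ F.base) (M : Bimod F G) (N : Bimod G H) (R : H.base ⟶ b) :
    Epi (L ◁ (π M N ▷ R)) :=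
  epiLR' L M N R

instance {b c : B} (M : Bimod F G) (N : Bimod G H) (R : H.base ⟶ b) (S : b ⟶ c) :
    Epi ((π M N ▷ R) ▷ S) :=
  epiRR M N R S

noncomputable def desc (M : Bimod F G) (N : Bimod G H) {Z : F.base ⟶ H.base} (k : M.X ≫ N.X ⟶ Z)
    (w : M.r ▷ N.X ≫ k = (α_ M.X G.cell N.X).hom ≫ M.X ◁ N.l ≫ k) : (tensor M N).X ⟶ Z :=
  desc₀ M N k w

@[simp] theorem π_desc (M : Bimod F G) (N : Bimod G H) {Z : F.base ⟶ H.base} (k : M.X ≫ N.X ⟶ Z)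
    (w : M.r ▷ N.X ≫ k = (α_ M.X G.cell N.X).hom ≫ M.X ◁ N.l ≫ k) :
    π M N ≫ desc M N k w = k :=
  π₀_desc M N k w

@[simp] theorem π_desc_assoc (M : Bimod F G) (N : Bimod G H) {Z : F.base ⟶ H.base} (k : M.X ≫ N.X ⟶ Z) (w : M.r ▷ N.X ≫ k = (α_ M.X G.cell N.X).hom ≫ M.X ◁ N.l ≫ k)
    {Z' : _} (h' : _ ⟶ Z') :
    π M N ≫ desc M N k w ≫ h' =
      k ≫ h' := by
  simpa only [Category.assoc] using congrArg (· ≫ h') (π_desc M N k w)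

noncomputable def descL {a : B} (L : a ⟶ F.base) (M : Bimod F G) (N : Bimod G H)
    {Z : a ⟶ H.base} (k : L ≫ M.X ≫ N.X ⟶ Z)
    (w : L ◁ (M.r ▷ N.X) ≫ k =
      L ◁ (α_ M.X G.cell N.X).hom ≫ L ◁ (M.X ◁ N.l) ≫ k) : L ≫ (tensor M N).X ⟶ Z :=
  descL₀ L M N k w

@[simp] theorem π_descL {a : B} (L : a ⟶ F.base) (M : Bimod F G) (N : Bimod G H)
    {Z : a ⟶ H.base} (k : L ≫ M.X ≫ N.X ⟶ Z)
    (w : L ◁ (M.r ▷ N.X) ≫ k =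
      L ◁ (α_ M.X G.cell N.X).hom ≫ L ◁ (M.X ◁ N.l) ≫ k) :
    L ◁ π M N ≫ descL L M N k w = k :=
  π₀_descL L M N k w

@[simp] theorem π_descL_assoc {a : B} (L : a ⟶ F.base) (M : Bimod F G) (N : Bimod G H) {Z : a ⟶ H.base} (k : L ≫ M.X ≫ N.X ⟶ Z) (w : L ◁ (M.r ▷ N.X) ≫ k =
      L ◁ (α_ M.X G.cell N.X).hom ≫ L ◁ (M.X ◁ N.l) ≫ k)
    {Z' : _} (h' : _ ⟶ Z') :
    L ◁ π M N ≫ descL L M N k w ≫ h' =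
      k ≫ h' := by
  simpa only [Category.assoc] using congrArg (· ≫ h') (π_descL L M N k w)

noncomputable def descR {b : B} (M : Bimod F G) (N : Bimod G H) (R : H.base ⟶ b)
    {Z : F.base ⟶ b} (k : (M.X ≫ N.X) ≫ R ⟶ Z)
    (w : (M.r ▷ N.X) ▷ R ≫ k =
      (α_ M.X G.cell N.X).hom ▷ R ≫ (M.X ◁ N.l) ▷ R ≫ k) : (tensor M N).X ≫ R ⟶ Z :=
  descR₀ M N R k w

@[simp] theorem π_descR {b : B} (M : Bimod F G) (N : Bimod G H) (R : H.base ⟶ b)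
    {Z : F.base ⟶ b} (k : (M.X ≫ N.X) ≫ R ⟶ Z)
    (w : (M.r ▷ N.X) ▷ R ≫ k =
      (α_ M.X G.cell N.X).hom ▷ R ≫ (M.X ◁ N.l) ▷ R ≫ k) :
    π M N ▷ R ≫ descR M N R k w = k :=
  π₀_descR M N R k w

@[simp] theorem π_descR_assoc {b : B} (M : Bimod F G) (N : Bimod G H) (R : H.base ⟶ b) {Z : F.base ⟶ b} (k : (M.X ≫ N.X) ≫ R ⟶ Z) (w : (M.r ▷ N.X) ▷ R ≫ k =
      (α_ M.X G.cell N.X).hom ▷ R ≫ (M.X ◁ N.l) ▷ R ≫ k)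
    {Z' : _} (h' : _ ⟶ Z') :
    π M N ▷ R ≫ descR M N R k w ≫ h' =
      k ≫ h' := by
  simpa only [Category.assoc] using congrArg (· ≫ h') (π_descR M N R k w)

@[simp] theorem π_tensor_l (M : Bimod F G) (N : Bimod G H) :
    F.cell ◁ π M N ≫ (tensor M N).l = (α_ _ _ _).inv ≫ M.l ▷ N.X ≫ π M N :=
  π₀_tl M N

@[simp] theorem π_tensor_l_assoc (M : Bimod F G) (N : Bimod G H)
    {Z' : _} (h' : _ ⟶ Z') :
    F.cell ◁ π M N ≫ (tensor M N).l ≫ h' =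
      (α_ _ _ _).inv ≫ M.l ▷ N.X ≫ π M N ≫ h' := by
  simpa only [Category.assoc] using congrArg (· ≫ h') (π_tensor_l M N)

@[simp] theorem π_tensor_r (M : Bimod F G) (N : Bimod G H) :
    π M N ▷ H.cell ≫ (tensor M N).r = (α_ _ _ _).hom ≫ M.X ◁ N.r ≫ π M N :=
  π₀_tr M N

@[simp] theorem π_tensor_r_assoc (M : Bimod F G) (N : Bimod G H)
    {Z' : _} (h' : _ ⟶ Z') :
    π M N ▷ H.cell ≫ (tensor M N).r ≫ h' =
      (α_ _ _ _).hom ≫ M.X ◁ N.r ≫ π M N ≫ h' := by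
  simpa only [Category.assoc] using congrArg (· ≫ h') (π_tensor_r M N)

noncomputable def wL (M : Bimod F G) {N N' : Bimod G H} (f : N ⟶ N') :
    tensor M N ⟶ tensor M N' where
  hom := desc M N (M.X ◁ f.hom ≫ π M N') (by
    slice_lhs 1 2 => rw [← whisker_exchange]
    slice_lhs 2 3 => rw [π_cond]
    slice_rhs 2 3 => rw [← whiskerLeft_comp, f.l_hom]
    simp)
  l_hom := by
    rw [← cancel_epi (F.cell ◁ π M N)]
    slice_lhs 1 2 => rw [π_tensor_l]
    slice_lhs 3 4 => rw [π_desc]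
    slice_rhs 1 2 => rw [← whiskerLeft_comp, π_desc, whiskerLeft_comp]
    slice_rhs 2 3 => rw [π_tensor_l]
    slice_rhs 1 2 => rw [associator_inv_naturality_right]
    slice_rhs 2 3 => rw [whisker_exchange]
    simp
  r_hom := by
    rw [← cancel_epi (π M N ▷ H.cell)]
    slice_lhs 1 2 => rw [π_tensor_r]
    slice_lhs 3 4 => rw [π_desc]
    slice_lhs 2 3 => rw [← whiskerLeft_comp, f.r_hom]
    slice_rhs 1 2 => rw [← comp_whiskerRight, π_desc, comp_whiskerRight]
    slice_rhs 2 3 => rw [π_tensor_r]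
    simp

noncomputable def wR {M M' : Bimod F G} (f : M ⟶ M') (N : Bimod G H) :
    tensor M N ⟶ tensor M' N where
  hom := desc M N (f.hom ▷ N.X ≫ π M' N) (by
    slice_lhs 1 2 => rw [← comp_whiskerRight, f.r_hom, comp_whiskerRight]
    slice_lhs 2 3 => rw [π_cond]
    slice_rhs 2 3 => rw [whisker_exchange]
    simp)
  l_hom := by
    rw [← cancel_epi (F.cell ◁ π M N)]
    slice_lhs 1 2 => rw [π_tensor_l]
    slice_lhs 3 4 => rw [π_desc]
    slice_lhs 2 3 => rw [← comp_whiskerRight, f.l_hom]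
    slice_rhs 1 2 => rw [← whiskerLeft_comp, π_desc, whiskerLeft_comp]
    slice_rhs 2 3 => rw [π_tensor_l]
    slice_rhs 1 2 => rw [associator_inv_naturality_middle]
    simp
  r_hom := by
    rw [← cancel_epi (π M N ▷ H.cell)]
    slice_lhs 1 2 => rw [π_tensor_r]
    slice_lhs 3 4 => rw [π_desc]
    slice_lhs 2 3 => rw [whisker_exchange]
    slice_rhs 1 2 => rw [← comp_whiskerRight, π_desc, comp_whiskerRight]
    slice_rhs 2 3 => rw [π_tensor_r]
    simp

@[simp] theorem π_wL (M : Bimod F G) {N N' : Bimod G H} (f : N ⟶ N') :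
    π M N ≫ (wL M f).hom = M.X ◁ f.hom ≫ π M N' := by
  simp only [wL, π_desc]

@[simp] theorem π_wL_assoc (M : Bimod F G) {N N' : Bimod G H} (f : N ⟶ N')
    {Z' : _} (h' : _ ⟶ Z') :
    π M N ≫ (wL M f).hom ≫ h' =
      M.X ◁ f.hom ≫ π M N' ≫ h' := by
  simpa only [Category.assoc] using congrArg (· ≫ h') (π_wL M f)

@[simp] theorem π_wR {M M' : Bimod F G} (f : M ⟶ M') (N : Bimod G H) :
    π M N ≫ (wR f N).hom = f.hom ▷ N.X ≫ π M' N := by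
  simp only [wR, π_desc]

@[simp] theorem π_wR_assoc {M M' : Bimod F G} (f : M ⟶ M') (N : Bimod G H)
    {Z' : _} (h' : _ ⟶ Z') :
    π M N ≫ (wR f N).hom ≫ h' =
      f.hom ▷ N.X ≫ π M' N ≫ h' := by
  simpa only [Category.assoc] using congrArg (· ≫ h') (π_wR f N)

theorem tensor_hom_ext {M : Bimod F G} {N : Bimod G H} {P : Bimod F H}
    {f g : tensor M N ⟶ P} (h : π M N ≫ f.hom = π M N ≫ g.hom) : f = g := by
  ext; exact (cancel_epi (π M N)).1 h

noncomputable def aHomAux (L : Bimod F G) (M : Bimod G H) (N : Bimod H K) :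
    (tensor L M).X ≫ N.X ⟶ (tensor L (tensor M N)).X :=
  descR L M N.X ((α_ _ _ _).hom ≫ L.X ◁ π M N ≫ π L (tensor M N)) (by
    slice_lhs 1 2 => rw [associator_naturality_left]
    slice_lhs 2 3 => rw [← whisker_exchange]
    slice_lhs 3 4 => rw [π_cond]
    slice_lhs 2 3 => rw [associator_naturality_right]
    slice_lhs 3 4 => rw [← whiskerLeft_comp, π_tensor_l, whiskerLeft_comp]
    simp)

@[simp] theorem π_aHomAux (L : Bimod F G) (M : Bimod G H) (N : Bimod H K) :
    π L M ▷ N.X ≫ aHomAux L M N = (α_ _ _ _).hom ≫ L.X ◁ π M N ≫ π L (tensor M N) :=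
  π_descR _ _ _ _ _

@[simp] theorem π_aHomAux_assoc (L : Bimod F G) (M : Bimod G H) (N : Bimod H K)
    {Z' : _} (h' : _ ⟶ Z') :
    π L M ▷ N.X ≫ aHomAux L M N ≫ h' =
      (α_ _ _ _).hom ≫ L.X ◁ π M N ≫ π L (tensor M N) ≫ h' := by
  simpa only [Category.assoc] using congrArg (· ≫ h') (π_aHomAux L M N)

noncomputable def aHom (L : Bimod F G) (M : Bimod G H) (N : Bimod H K) :
    (tensor (tensor L M) N).X ⟶ (tensor L (tensor M N)).X :=
  desc (tensor L M) N (aHomAux L M N) (by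
    rw [← cancel_epi ((π L M ▷ H.cell) ▷ N.X)]
    slice_lhs 1 2 => rw [← comp_whiskerRight, π_tensor_r, comp_whiskerRight, comp_whiskerRight]
    slice_lhs 3 4 => rw [π_aHomAux]
    slice_lhs 2 3 => rw [associator_naturality_middle]
    slice_lhs 3 4 => rw [← whiskerLeft_comp, π_cond, whiskerLeft_comp, whiskerLeft_comp]
    slice_rhs 1 2 => rw [associator_naturality_left]
    slice_rhs 2 3 => rw [← whisker_exchange]
    slice_rhs 3 4 => rw [π_aHomAux]
    simp)

@[simp] theorem ππ_aHom (L : Bimod F G) (M : Bimod G H) (N : Bimod H K) :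
    π L M ▷ N.X ≫ π (tensor L M) N ≫ aHom L M N =
      (α_ _ _ _).hom ≫ L.X ◁ π M N ≫ π L (tensor M N) := by
  rw [← π_aHomAux]
  exact congrArg (π L M ▷ N.X ≫ ·) (π_desc _ _ _ _)

@[simp] theorem ππ_aHom_assoc (L : Bimod F G) (M : Bimod G H) (N : Bimod H K)
    {Z' : _} (h' : _ ⟶ Z') :
    π L M ▷ N.X ≫ π (tensor L M) N ≫ aHom L M N ≫ h' =
      (α_ _ _ _).hom ≫ L.X ◁ π M N ≫ π L (tensor M N) ≫ h' := by
  simpa only [Category.assoc] using congrArg (· ≫ h') (ππ_aHom L M N)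

noncomputable def aInvAux (L : Bimod F G) (M : Bimod G H) (N : Bimod H K) :
    L.X ≫ (tensor M N).X ⟶ (tensor (tensor L M) N).X :=
  descL L.X M N ((α_ _ _ _).inv ≫ π L M ▷ N.X ≫ π (tensor L M) N) (by
    slice_lhs 1 2 => rw [associator_inv_naturality_middle]
    have e : (L.X ◁ M.r) ▷ N.X ≫ π L M ▷ N.X =
        (α_ _ _ _).inv ▷ N.X ≫ (π L M ▷ H.cell) ▷ N.X ≫ (tensor L M).r ▷ N.X := by
      rw [← comp_whiskerRight, ← comp_whiskerRight, ← comp_whiskerRight, π_tensor_r]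
      simp
    slice_lhs 2 3 => rw [e]
    slice_lhs 4 5 => rw [π_cond]
    slice_lhs 3 4 => rw [associator_naturality_left]
    slice_rhs 2 3 => rw [associator_inv_naturality_right]
    slice_rhs 3 4 => rw [whisker_exchange]
    simp)

@[simp] theorem π_aInvAux (L : Bimod F G) (M : Bimod G H) (N : Bimod H K) :
    L.X ◁ π M N ≫ aInvAux L M N = (α_ _ _ _).inv ≫ π L M ▷ N.X ≫ π (tensor L M) N :=
  π_descL _ _ _ _ _

@[simp] theorem π_aInvAux_assoc (L : Bimod F G) (M : Bimod G H) (N : Bimod H K)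
    {Z' : _} (h' : _ ⟶ Z') :
    L.X ◁ π M N ≫ aInvAux L M N ≫ h' =
      (α_ _ _ _).inv ≫ π L M ▷ N.X ≫ π (tensor L M) N ≫ h' := by
  simpa only [Category.assoc] using congrArg (· ≫ h') (π_aInvAux L M N)

noncomputable def aInv (L : Bimod F G) (M : Bimod G H) (N : Bimod H K) :
    (tensor L (tensor M N)).X ⟶ (tensor (tensor L M) N).X :=
  desc L (tensor M N) (aInvAux L M N) (by
    rw [← cancel_epi ((L.X ≫ G.cell) ◁ π M N)]
    slice_lhs 1 2 => rw [whisker_exchange]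
    slice_lhs 2 3 => rw [π_aInvAux]
    slice_lhs 1 2 => rw [associator_inv_naturality_left]
    slice_lhs 2 3 => rw [← comp_whiskerRight, π_cond, comp_whiskerRight, comp_whiskerRight]
    slice_rhs 1 2 => rw [associator_naturality_right]
    slice_rhs 2 3 => rw [← whiskerLeft_comp, π_tensor_l, whiskerLeft_comp, whiskerLeft_comp]
    slice_rhs 4 5 => rw [π_aInvAux]
    slice_rhs 3 4 => rw [associator_inv_naturality_middle]
    simp)

@[simp] theorem ππ_aInv (L : Bimod F G) (M : Bimod G H) (N : Bimod H K) :
    L.X ◁ π M N ≫ π L (tensor M N) ≫ aInv L M N =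
      (α_ _ _ _).inv ≫ π L M ▷ N.X ≫ π (tensor L M) N := by
  rw [← π_aInvAux]
  exact congrArg (L.X ◁ π M N ≫ ·) (π_desc _ _ _ _)

@[simp] theorem ππ_aInv_assoc (L : Bimod F G) (M : Bimod G H) (N : Bimod H K)
    {Z' : _} (h' : _ ⟶ Z') :
    L.X ◁ π M N ≫ π L (tensor M N) ≫ aInv L M N ≫ h' =
      (α_ _ _ _).inv ≫ π L M ▷ N.X ≫ π (tensor L M) N ≫ h' := by
  simpa only [Category.assoc] using congrArg (· ≫ h') (ππ_aInv L M N)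

end Bimod
end Bimodules
end PropMonads

namespace PropMonads

open CategoryTheory Bicategory Limits

universe w v u

section Bimodules

variable {B : Type u} [Bicategory.{w, v} B] [HasStableReflexiveCoequalizers B]
namespace Bimod
variable {F G H K J : ModCat B}

theorem aHom_l (L : Bimod F G) (M : Bimod G H) (N : Bimod H K) :
    (tensor (tensor L M) N).l ≫ aHom L M N =
      F.cell ◁ aHom L M N ≫ (tensor L (tensor M N)).l := by
  rw [← cancel_epi (F.cell ◁ π (tensor L M) N), ← cancel_epi (F.cell ◁ π L M ▷ N.X)]
  slice_lhs 2 3 => rw [π_tensor_l]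
  slice_lhs 1 2 => rw [associator_inv_naturality_middle]
  slice_lhs 2 3 => rw [← comp_whiskerRight, π_tensor_l, comp_whiskerRight, comp_whiskerRight]
  slice_lhs 4 6 => rw [ππ_aHom]
  slice_lhs 3 4 => rw [associator_naturality_left]
  slice_rhs 1 3 => rw [← whiskerLeft_comp, ← whiskerLeft_comp, ππ_aHom, whiskerLeft_comp,
    whiskerLeft_comp]
  slice_rhs 3 4 => rw [π_tensor_l]
  slice_rhs 2 3 => rw [associator_inv_naturality_right]
  slice_rhs 3 4 => rw [whisker_exchange]
  simp

theorem aHom_r (L : Bimod F G) (M : Bimod G H) (N : Bimod H K) :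
    (tensor (tensor L M) N).r ≫ aHom L M N =
      aHom L M N ▷ K.cell ≫ (tensor L (tensor M N)).r := by
  rw [← cancel_epi (π (tensor L M) N ▷ K.cell), ← cancel_epi ((π L M ▷ N.X) ▷ K.cell)]
  slice_lhs 2 3 => rw [π_tensor_r]
  slice_lhs 1 2 => rw [associator_naturality_left]
  slice_lhs 2 3 => rw [← whisker_exchange]
  slice_lhs 3 5 => rw [ππ_aHom]
  slice_lhs 2 3 => rw [associator_naturality_right]
  slice_rhs 1 3 => rw [← comp_whiskerRight, ← comp_whiskerRight, ππ_aHom, comp_whiskerRight,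
    comp_whiskerRight]
  slice_rhs 3 4 => rw [π_tensor_r]
  slice_rhs 2 3 => rw [associator_naturality_middle]
  slice_rhs 3 4 => rw [← whiskerLeft_comp, π_tensor_r, whiskerLeft_comp, whiskerLeft_comp]
  simp

theorem aHom_aInv (L : Bimod F G) (M : Bimod G H) (N : Bimod H K) :
    aHom L M N ≫ aInv L M N = 𝟙 _ := by
  rw [← cancel_epi (π (tensor L M) N), ← cancel_epi (π L M ▷ N.X)]
  rw [ππ_aHom_assoc, ππ_aInv, Iso.hom_inv_id_assoc, Category.comp_id]

theorem aInv_aHom (L : Bimod F G) (M : Bimod G H) (N : Bimod H K) :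
    aInv L M N ≫ aHom L M N = 𝟙 _ := by
  rw [← cancel_epi (π L (tensor M N)), ← cancel_epi (L.X ◁ π M N)]
  rw [ππ_aInv_assoc, ππ_aHom, Iso.inv_hom_id_assoc, Category.comp_id]

noncomputable def assoc (L : Bimod F G) (M : Bimod G H) (N : Bimod H K) :
    tensor (tensor L M) N ≅ tensor L (tensor M N) :=
  mkIso ⟨aHom L M N, aHom_l L M N, aHom_r L M N⟩ (aInv L M N) (aHom_aInv L M N) (aInv_aHom L M N)

@[simp] theorem ππ_assoc_hom (L : Bimod F G) (M : Bimod G H) (N : Bimod H K) :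
    π L M ▷ N.X ≫ π (tensor L M) N ≫ (assoc L M N).hom.hom =
      (α_ _ _ _).hom ≫ L.X ◁ π M N ≫ π L (tensor M N) := ππ_aHom L M N

@[simp] theorem ππ_assoc_hom_assoc (L : Bimod F G) (M : Bimod G H) (N : Bimod H K)
    {Z' : _} (h' : _ ⟶ Z') :
    π L M ▷ N.X ≫ π (tensor L M) N ≫ (assoc L M N).hom.hom ≫ h' =
      (α_ _ _ _).hom ≫ L.X ◁ π M N ≫ π L (tensor M N) ≫ h' := by
  simpa only [Category.assoc] using congrArg (· ≫ h') (ππ_assoc_hom L M N)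

@[simp] theorem ππ_assoc_inv (L : Bimod F G) (M : Bimod G H) (N : Bimod H K) :
    L.X ◁ π M N ≫ π L (tensor M N) ≫ (assoc L M N).inv.hom =
      (α_ _ _ _).inv ≫ π L M ▷ N.X ≫ π (tensor L M) N := ππ_aInv L M N

@[simp] theorem ππ_assoc_inv_assoc (L : Bimod F G) (M : Bimod G H) (N : Bimod H K)
    {Z' : _} (h' : _ ⟶ Z') :
    L.X ◁ π M N ≫ π L (tensor M N) ≫ (assoc L M N).inv.hom ≫ h' =
      (α_ _ _ _).inv ≫ π L M ▷ N.X ≫ π (tensor L M) N ≫ h' := by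
  simpa only [Category.assoc] using congrArg (· ≫ h') (ππ_assoc_inv L M N)

theorem π_regular_left (M : Bimod F G) :
    F.cell ◁ M.l ≫ π (regular F) M =
      (α_ F.cell F.cell M.X).inv ≫ F.monad.μ ▷ M.X ≫ π (regular F) M := by
  rw [show F.monad.μ ▷ M.X ≫ π (regular F) M = _ from π_cond (regular F) M, Iso.inv_hom_id_assoc]

theorem π_regular_right (M : Bimod F G) :
    M.r ▷ G.cell ≫ π M (regular G) =
      (α_ M.X G.cell G.cell).hom ≫ M.X ◁ G.monad.μ ≫ π M (regular G) :=
  π_cond M (regular G)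

noncomputable def lHom (M : Bimod F G) : tensor (regular F) M ⟶ M where
  hom := desc (regular F) M M.l M.str.mul_l
  l_hom := by
    rw [← cancel_epi (F.cell ◁ π (regular F) M), π_tensor_l_assoc, π_desc, ← whiskerLeft_comp_assoc,
      π_desc, M.str.mul_l, Iso.inv_hom_id_assoc]
  r_hom := by
    rw [← cancel_epi (π (regular F) M ▷ G.cell), π_tensor_r_assoc, π_desc, ← comp_whiskerRight_assoc,
      π_desc, M.str.middle]

noncomputable def lInv (M : Bimod F G) : M.X ⟶ (tensor (regular F) M).X :=
  (λ_ M.X).inv ≫ F.monad.η ▷ M.X ≫ π (regular F) M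

theorem lHom_lInv (M : Bimod F G) : (lHom M).hom ≫ lInv M = 𝟙 _ := by
  rw [← cancel_epi (π (regular F) M), lHom, π_desc_assoc, lInv, leftUnitor_inv_naturality_assoc,
    whisker_exchange_assoc, π_regular_left, associator_inv_naturality_left_assoc,
    ← comp_whiskerRight_assoc, F.monad.η_μ]
  simp

theorem lInv_lHom (M : Bimod F G) : lInv M ≫ (lHom M).hom = 𝟙 _ := by
  rw [lInv, lHom, Category.assoc, Category.assoc, π_desc, M.str.unit_l, Iso.inv_hom_id]

noncomputable def lUnit (M : Bimod F G) : tensor (regular F) M ≅ M :=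
  mkIso (lHom M) (lInv M) (lHom_lInv M) (lInv_lHom M)

noncomputable def rHom (M : Bimod F G) : tensor M (regular G) ⟶ M where
  hom := desc M (regular G) M.r (by rw [M.str.mul_r, Iso.hom_inv_id_assoc])
  l_hom := by
    rw [← cancel_epi (F.cell ◁ π M (regular G)), π_tensor_l_assoc, π_desc, ← whiskerLeft_comp_assoc,
      π_desc, M.str.middle, Iso.inv_hom_id_assoc]
  r_hom := by
    rw [← cancel_epi (π M (regular G) ▷ G.cell), π_tensor_r_assoc, π_desc, ← comp_whiskerRight_assoc,
      π_desc, M.str.mul_r, Iso.hom_inv_id_assoc]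

noncomputable def rInv (M : Bimod F G) : M.X ⟶ (tensor M (regular G)).X :=
  (ρ_ M.X).inv ≫ M.X ◁ G.monad.η ≫ π M (regular G)

theorem rHom_rInv (M : Bimod F G) : (rHom M).hom ≫ rInv M = 𝟙 _ := by
  rw [← cancel_epi (π M (regular G)), rHom, π_desc_assoc, rInv, rightUnitor_inv_naturality_assoc,
    ← whisker_exchange_assoc, π_regular_right, associator_naturality_right_assoc,
    ← whiskerLeft_comp_assoc, G.monad.μ_η]
  simp

theorem rInv_rHom (M : Bimod F G) : rInv M ≫ (rHom M).hom = 𝟙 _ := by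
  rw [rInv, rHom, Category.assoc, Category.assoc, π_desc, M.str.unit_r, Iso.inv_hom_id]

noncomputable def rUnit (M : Bimod F G) : tensor M (regular G) ≅ M :=
  mkIso (rHom M) (rInv M) (rHom_rInv M) (rInv_rHom M)

@[simp] theorem π_lUnit_hom (M : Bimod F G) : π (regular F) M ≫ (lUnit M).hom.hom = M.l :=
  π_desc _ _ _ M.str.mul_l

@[simp] theorem π_lUnit_hom_assoc (M : Bimod F G)
    {Z' : _} (h' : _ ⟶ Z') :
    π (regular F) M ≫ (lUnit M).hom.hom ≫ h' =
      M.l ≫ h' := by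
  simpa only [Category.assoc] using congrArg (· ≫ h') (π_lUnit_hom M)

@[simp] theorem π_rUnit_hom (M : Bimod F G) : π M (regular G) ≫ (rUnit M).hom.hom = M.r := by
  rw [rUnit, mkIso_hom, rHom, π_desc]

@[simp] theorem π_rUnit_hom_assoc (M : Bimod F G)
    {Z' : _} (h' : _ ⟶ Z') :
    π M (regular G) ≫ (rUnit M).hom.hom ≫ h' =
      M.r ≫ h' := by
  simpa only [Category.assoc] using congrArg (· ≫ h') (π_rUnit_hom M)

theorem cancelAssoc {L : Bimod F G} {M : Bimod G H} {N : Bimod H K} {P : Bimod F K}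
    {f g : tensor (tensor L M) N ⟶ P}
    (h : π L M ▷ N.X ≫ π (tensor L M) N ≫ f.hom = π L M ▷ N.X ≫ π (tensor L M) N ≫ g.hom) :
    f = g :=
  tensor_hom_ext ((cancel_epi (π L M ▷ N.X)).1 h)

theorem id_wL {M N : Bimod F G} (f : M ⟶ N) :
    wL (regular F) f = (lUnit M).hom ≫ f ≫ (lUnit N).inv := by
  rw [← Category.assoc, Iso.eq_comp_inv]
  refine tensor_hom_ext ?_
  rw [comp_hom, comp_hom, π_wL_assoc, π_lUnit_hom, π_lUnit_hom_assoc, f.l_hom]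

theorem wR_id {M N : Bimod F G} (f : M ⟶ N) :
    wR f (regular G) = (rUnit M).hom ≫ f ≫ (rUnit N).inv := by
  rw [← Category.assoc, Iso.eq_comp_inv]
  refine tensor_hom_ext ?_
  rw [comp_hom, comp_hom, π_wR_assoc, π_rUnit_hom, π_rUnit_hom_assoc, f.r_hom]

theorem tensor_wL (L : Bimod F G) (M : Bimod G H) {N N' : Bimod H K} (f : N ⟶ N') :
    wL (tensor L M) f = (assoc L M N).hom ≫ wL L (wL M f) ≫ (assoc L M N').inv := by
  rw [← Category.assoc, Iso.eq_comp_inv]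
  refine cancelAssoc ?_
  rw [comp_hom, comp_hom, π_wL_assoc, ← whisker_exchange_assoc, ππ_assoc_hom, ππ_assoc_hom_assoc,
    π_wL, ← whiskerLeft_comp_assoc, π_wL]
  simp

theorem wR_tensor {L L' : Bimod F G} (f : L ⟶ L') (M : Bimod G H) (N : Bimod H K) :
    wR f (tensor M N) = (assoc L M N).inv ≫ wR (wR f M) N ≫ (assoc L' M N).hom := by
  rw [Iso.eq_inv_comp]
  refine cancelAssoc ?_
  rw [comp_hom, comp_hom, π_wR_assoc, ππ_assoc_hom_assoc, π_wR, ← comp_whiskerRight_assoc, π_wR,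
    comp_whiskerRight_assoc, ππ_assoc_hom, whisker_exchange_assoc]
  simp

theorem wR_wL (L : Bimod F G) {M M' : Bimod G H} (f : M ⟶ M') (N : Bimod H K) :
    wR (wL L f) N = (assoc L M N).hom ≫ wL L (wR f N) ≫ (assoc L M' N).inv := by
  rw [← Category.assoc, Iso.eq_comp_inv]
  refine cancelAssoc ?_
  rw [comp_hom, comp_hom, π_wR_assoc, ππ_assoc_hom_assoc, π_wL, ← comp_whiskerRight_assoc, π_wL,
    comp_whiskerRight_assoc, ππ_assoc_hom, ← whiskerLeft_comp_assoc, π_wR]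
  simp

theorem wL_wR {M M' : Bimod F G} {N N' : Bimod G H} (f : M ⟶ M') (g : N ⟶ N') :
    wL M g ≫ wR f N' = wR f N ≫ wL M' g := by
  refine tensor_hom_ext ?_
  rw [comp_hom, comp_hom, π_wL_assoc, π_wR_assoc, π_wL, π_wR, whisker_exchange_assoc]

theorem pentagon (L : Bimod F G) (M : Bimod G H) (N : Bimod H K) (P : Bimod K J) :
    wR (assoc L M N).hom P ≫ (assoc L (tensor M N) P).hom ≫ wL L (assoc M N P).hom =
      (assoc (tensor L M) N P).hom ≫ (assoc L M (tensor N P)).hom := by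
  refine cancelAssoc ((cancel_epi ((π L M ▷ N.X) ▷ P.X)).1 ?_)
  simp only [comp_hom]
  have e₁ : (π L M ▷ N.X) ▷ P.X ≫ π (tensor L M) N ▷ P.X ≫ (assoc L M N).hom.hom ▷ P.X =
      (α_ _ _ _).hom ▷ P.X ≫ (L.X ◁ π M N) ▷ P.X ≫ π L (tensor M N) ▷ P.X := by
    simp only [← comp_whiskerRight, ππ_assoc_hom]
  have e₁' {Z : _} (k : _ ⟶ Z) := congrArg (· ≫ k) e₁
  have e₂ : L.X ◁ (π M N ▷ P.X) ≫ L.X ◁ π (tensor M N) P ≫ L.X ◁ (assoc M N P).hom.hom =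
      L.X ◁ (α_ _ _ _).hom ≫ L.X ◁ (M.X ◁ π N P) ≫ L.X ◁ π M (tensor N P) := by
    simp only [← whiskerLeft_comp, ππ_assoc_hom]
  have e₂' {Z : _} (k : _ ⟶ Z) := congrArg (· ≫ k) e₂
  simp only [Category.assoc] at e₁' e₂'
  rw [π_wR_assoc, ππ_assoc_hom_assoc, e₁', ππ_assoc_hom_assoc, π_wL,
    associator_naturality_left_assoc, ← whisker_exchange_assoc, ππ_assoc_hom,
    associator_naturality_middle_assoc, e₂']
  simp

theorem triangle (M : Bimod F G) (N : Bimod G H) :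
    (assoc M (regular G) N).hom ≫ wL M (lUnit N).hom = wR (rUnit M).hom N := by
  refine cancelAssoc ?_
  rw [comp_hom, ππ_assoc_hom_assoc, π_wL, π_wR, ← whiskerLeft_comp_assoc, π_lUnit_hom,
    ← comp_whiskerRight_assoc, π_rUnit_hom, π_cond]

/-- The bicategory of bimodules in `B`: objects are monads, 1-cells are bimodules, 2-cells are
bimodule morphisms, composition of 1-cells is by coequalizer. -/
noncomputable instance : Bicategory (ModCat B) where
  Hom F G := Bimod F G
  homCategory F G := Bimod.category F G
  id F := regular F
  comp M N := tensor M N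
  whiskerLeft M _ _ f := wL M f
  whiskerRight f N := wR f N
  associator := assoc
  leftUnitor := lUnit
  rightUnitor := rUnit
  whiskerLeft_id M N := tensor_hom_ext (by simp)
  whiskerLeft_comp M _ _ _ f g := tensor_hom_ext (by simp)
  id_whiskerRight M N := tensor_hom_ext (by simp)
  comp_whiskerRight f g N := tensor_hom_ext (by simp)
  id_whiskerLeft f := id_wL f
  comp_whiskerLeft L M _ _ f := tensor_wL L M f
  whiskerRight_id f := wR_id f
  whiskerRight_comp f M N := wR_tensor f M N
  whisker_assoc L _ _ f N := wR_wL L f N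
  whisker_exchange f g := wL_wR f g
  pentagon := pentagon
  triangle := triangle

end Bimod
end Bimodules
end PropMonads

namespace PropMonads

open CategoryTheory Bicategory Limits

universe v u

section Spans

/-- The objects of the bicategory of spans in `C`: the objects of `C`. -/
structure SpanCat (C : Type u) where
  of : C

variable {C : Type u} [Category.{v} C]

/-- The 1-cells of the bicategory of spans: spans in `C`, with no condition on the legs. -/
abbrev Sp (x y : SpanCat C) := Span (C := C) ⊤ ⊤ x.of y.of

namespace Sp

/-- A span from its two legs. -/
abbrev mk {x y : SpanCat C} {A : C} (l : A ⟶ x.of) (r : A ⟶ y.of) : Sp x y :=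
  ⟨A, l, r, trivial, trivial⟩

variable [HasPullbacks C] {x y z w t : SpanCat C}

/-- The composite span, by pullback. -/
noncomputable def comp (S : Sp x y) (T : Sp y z) : Sp x z :=
  Span.comp S T

/-- The two projections of the pullback. -/
noncomputable def p₁ (S : Sp x y) (T : Sp y z) : (comp S T).apex ⟶ S.apex :=
  pullback.fst S.r T.l

noncomputable def p₂ (S : Sp x y) (T : Sp y z) : (comp S T).apex ⟶ T.apex :=
  pullback.snd S.r T.l

theorem cond (S : Sp x y) (T : Sp y z) : p₁ S T ≫ S.r = p₂ S T ≫ T.l :=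
  pullback.condition

theorem cond_assoc (S : Sp x y) (T : Sp y z)
    {Z' : _} (h' : _ ⟶ Z') :
    p₁ S T ≫ S.r ≫ h' =
      p₂ S T ≫ T.l ≫ h' := by
  simpa only [Category.assoc] using congrArg (· ≫ h') (cond S T)

theorem isPullback (S : Sp x y) (T : Sp y z) : IsPullback (p₁ S T) (p₂ S T) S.r T.l :=
  IsPullback.of_hasPullback _ _

@[simp] theorem comp_l (S : Sp x y) (T : Sp y z) : (comp S T).l = p₁ S T ≫ S.l := rfl

@[simp] theorem comp_l_assoc (S : Sp x y) (T : Sp y z)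
    {Z' : _} (h' : _ ⟶ Z') :
    (comp S T).l ≫ h' =
      p₁ S T ≫ S.l ≫ h' := by
  simpa only [Category.assoc] using congrArg (· ≫ h') (comp_l S T)
@[simp] theorem comp_r (S : Sp x y) (T : Sp y z) : (comp S T).r = p₂ S T ≫ T.r := rfl

@[simp] theorem comp_r_assoc (S : Sp x y) (T : Sp y z)
    {Z' : _} (h' : _ ⟶ Z') :
    (comp S T).r ≫ h' =
      p₂ S T ≫ T.r ≫ h' := by
  simpa only [Category.assoc] using congrArg (· ≫ h') (comp_r S T)

noncomputable def lift {A : C} {S : Sp x y} {T : Sp y z} (f : A ⟶ S.apex) (g : A ⟶ T.apex)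
    (h : f ≫ S.r = g ≫ T.l) : A ⟶ (comp S T).apex :=
  pullback.lift f g h

@[simp] theorem lift_p₁ {A : C} {S : Sp x y} {T : Sp y z} (f : A ⟶ S.apex) (g : A ⟶ T.apex)
    (h : f ≫ S.r = g ≫ T.l) : lift f g h ≫ p₁ S T = f :=
  pullback.lift_fst _ _ _

@[simp] theorem lift_p₁_assoc {A : C} {S : Sp x y} {T : Sp y z} (f : A ⟶ S.apex) (g : A ⟶ T.apex) (h : f ≫ S.r = g ≫ T.l)
    {Z' : _} (h' : _ ⟶ Z') :
    lift f g h ≫ p₁ S T ≫ h' =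
      f ≫ h' := by
  simpa only [Category.assoc] using congrArg (· ≫ h') (lift_p₁ f g h)

@[simp] theorem lift_p₂ {A : C} {S : Sp x y} {T : Sp y z} (f : A ⟶ S.apex) (g : A ⟶ T.apex)
    (h : f ≫ S.r = g ≫ T.l) : lift f g h ≫ p₂ S T = g :=
  pullback.lift_snd _ _ _

@[simp] theorem lift_p₂_assoc {A : C} {S : Sp x y} {T : Sp y z} (f : A ⟶ S.apex) (g : A ⟶ T.apex) (h : f ≫ S.r = g ≫ T.l)
    {Z' : _} (h' : _ ⟶ Z') :
    lift f g h ≫ p₂ S T ≫ h' =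
      g ≫ h' := by
  simpa only [Category.assoc] using congrArg (· ≫ h') (lift_p₂ f g h)

@[ext]
theorem comp_ext {A : C} {S : Sp x y} {T : Sp y z} {f g : A ⟶ (comp S T).apex}
    (h₁ : f ≫ p₁ S T = g ≫ p₁ S T) (h₂ : f ≫ p₂ S T = g ≫ p₂ S T) : f = g :=
  pullback.hom_ext h₁ h₂

/-- Horizontal composition of span morphisms, by the universal property of the pullback. -/
noncomputable def wL (S : Sp x y) {T T' : Sp y z} (h : T ⟶ T') : comp S T ⟶ comp S T' where
  hom := lift (p₁ S T) (p₂ S T ≫ h.hom) (by simp [cond])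

noncomputable def wR {S S' : Sp x y} (h : S ⟶ S') (T : Sp y z) : comp S T ⟶ comp S' T where
  hom := lift (p₁ S T ≫ h.hom) (p₂ S T) (by simp [cond])

@[simp] theorem wL_p₁ (S : Sp x y) {T T' : Sp y z} (h : T ⟶ T') : (wL S h).hom ≫ p₁ S T' = p₁ S T :=
  lift_p₁ _ _ _

@[simp] theorem wL_p₁_assoc (S : Sp x y) {T T' : Sp y z} (h : T ⟶ T')
    {Z' : _} (h' : _ ⟶ Z') :
    (wL S h).hom ≫ p₁ S T' ≫ h' =
      p₁ S T ≫ h' := by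
  simpa only [Category.assoc] using congrArg (· ≫ h') (wL_p₁ S h)
@[simp] theorem wL_p₂ (S : Sp x y) {T T' : Sp y z} (h : T ⟶ T') :
    (wL S h).hom ≫ p₂ S T' = p₂ S T ≫ h.hom := lift_p₂ _ _ _

@[simp] theorem wL_p₂_assoc (S : Sp x y) {T T' : Sp y z} (h : T ⟶ T')
    {Z' : _} (h' : _ ⟶ Z') :
    (wL S h).hom ≫ p₂ S T' ≫ h' =
      p₂ S T ≫ h.hom ≫ h' := by
  simpa only [Category.assoc] using congrArg (· ≫ h') (wL_p₂ S h)
@[simp] theorem wR_p₁ {S S' : Sp x y} (h : S ⟶ S') (T : Sp y z) :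
    (wR h T).hom ≫ p₁ S' T = p₁ S T ≫ h.hom := lift_p₁ _ _ _

@[simp] theorem wR_p₁_assoc {S S' : Sp x y} (h : S ⟶ S') (T : Sp y z)
    {Z' : _} (h' : _ ⟶ Z') :
    (wR h T).hom ≫ p₁ S' T ≫ h' =
      p₁ S T ≫ h.hom ≫ h' := by
  simpa only [Category.assoc] using congrArg (· ≫ h') (wR_p₁ h T)
@[simp] theorem wR_p₂ {S S' : Sp x y} (h : S ⟶ S') (T : Sp y z) : (wR h T).hom ≫ p₂ S' T = p₂ S T :=
  lift_p₂ _ _ _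

@[simp] theorem wR_p₂_assoc {S S' : Sp x y} (h : S ⟶ S') (T : Sp y z)
    {Z' : _} (h' : _ ⟶ Z') :
    (wR h T).hom ≫ p₂ S' T ≫ h' =
      p₂ S T ≫ h' := by
  simpa only [Category.assoc] using congrArg (· ≫ h') (wR_p₂ h T)

noncomputable def assoc (S : Sp x y) (T : Sp y z) (U : Sp z w) :
    comp (comp S T) U ≅ comp S (comp T U) where
  hom :=
    { hom := lift (p₁ _ U ≫ p₁ S T) (lift (p₁ _ U ≫ p₂ S T) (p₂ _ U)
        (by have := cond (comp S T) U; simpa using this)) (by simp [cond]) }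
  inv :=
    { hom := lift (lift (p₁ S _) (p₂ S _ ≫ p₁ T U)
        (by have := cond S (comp T U); simpa using this)) (p₂ S _ ≫ p₂ T U) (by simp [cond]) }
  hom_inv_id := by
    refine Span.hom_ext (comp_ext (comp_ext ?_ ?_) ?_) <;> simp
  inv_hom_id := by
    refine Span.hom_ext (comp_ext ?_ (comp_ext ?_ ?_)) <;> simp

@[simp] theorem assoc_hom_p₁ (S : Sp x y) (T : Sp y z) (U : Sp z w) :
    (assoc S T U).hom.hom ≫ p₁ _ _ = p₁ _ _ ≫ p₁ _ _ := lift_p₁ _ _ _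

@[simp] theorem assoc_hom_p₁_assoc (S : Sp x y) (T : Sp y z) (U : Sp z w)
    {Z' : _} (h' : _ ⟶ Z') :
    (assoc S T U).hom.hom ≫ p₁ _ _ ≫ h' =
      p₁ _ _ ≫ p₁ _ _ ≫ h' := by
  simpa only [Category.assoc] using congrArg (· ≫ h') (assoc_hom_p₁ S T U)
@[simp] theorem assoc_hom_p₂ (S : Sp x y) (T : Sp y z) (U : Sp z w) :
    (assoc S T U).hom.hom ≫ p₂ S (comp T U) =
      lift (p₁ _ U ≫ p₂ S T) (p₂ _ U)
        (by have := cond (comp S T) U; simpa using this) := lift_p₂ _ _ _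

@[simp] theorem assoc_hom_p₂_assoc (S : Sp x y) (T : Sp y z) (U : Sp z w)
    {Z' : _} (h' : _ ⟶ Z') :
    (assoc S T U).hom.hom ≫ p₂ S (comp T U) ≫ h' =
      lift (p₁ _ U ≫ p₂ S T) (p₂ _ U)
        (by have := cond (comp S T) U; simpa using this) ≫ h' := by
  simpa only [Category.assoc] using congrArg (· ≫ h') (assoc_hom_p₂ S T U)
@[simp] theorem assoc_inv_p₁ (S : Sp x y) (T : Sp y z) (U : Sp z w) :
    (assoc S T U).inv.hom ≫ p₁ (comp S T) U =
      lift (p₁ S _) (p₂ S _ ≫ p₁ T U)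
        (by have := cond S (comp T U); simpa using this) := lift_p₁ _ _ _

@[simp] theorem assoc_inv_p₁_assoc (S : Sp x y) (T : Sp y z) (U : Sp z w)
    {Z' : _} (h' : _ ⟶ Z') :
    (assoc S T U).inv.hom ≫ p₁ (comp S T) U ≫ h' =
      lift (p₁ S _) (p₂ S _ ≫ p₁ T U)
        (by have := cond S (comp T U); simpa using this) ≫ h' := by
  simpa only [Category.assoc] using congrArg (· ≫ h') (assoc_inv_p₁ S T U)
@[simp] theorem assoc_inv_p₂ (S : Sp x y) (T : Sp y z) (U : Sp z w) :
    (assoc S T U).inv.hom ≫ p₂ _ _ = p₂ _ _ ≫ p₂ _ _ := lift_p₂ _ _ _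

@[simp] theorem assoc_inv_p₂_assoc (S : Sp x y) (T : Sp y z) (U : Sp z w)
    {Z' : _} (h' : _ ⟶ Z') :
    (assoc S T U).inv.hom ≫ p₂ _ _ ≫ h' =
      p₂ _ _ ≫ p₂ _ _ ≫ h' := by
  simpa only [Category.assoc] using congrArg (· ≫ h') (assoc_inv_p₂ S T U)

/-- The identity span. -/
abbrev one (x : SpanCat C) : Sp x x := mk (𝟙 x.of) (𝟙 x.of)

noncomputable def lUnit (S : Sp x y) : comp (one x) S ≅ S where
  hom := { hom := p₂ _ S
           hom_l := by have := cond (one x) S; simpa  using this.symm }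
  inv := { hom := lift S.l (𝟙 _) (by simp )
           hom_l := by simp  }
  hom_inv_id := by
    refine Span.hom_ext (comp_ext ?_ ?_)
    · have := cond (one x) S; simpa  using this.symm
    · simp
  inv_hom_id := Span.hom_ext (by simp)

noncomputable def rUnit (S : Sp x y) : comp S (one y) ≅ S where
  hom := { hom := p₁ S _
           hom_r := by have := cond S (one y); simpa  using this }
  inv := { hom := lift (𝟙 _) S.r (by simp )
           hom_r := by simp  }
  hom_inv_id := by
    refine Span.hom_ext (comp_ext ?_ ?_)
    · simp
    · have := cond S (one y); simpa  using this
  inv_hom_id := Span.hom_ext (by simp)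

@[simp] theorem lUnit_hom (S : Sp x y) : (lUnit S).hom.hom = p₂ (one x) S := rfl
@[simp] theorem rUnit_hom (S : Sp x y) : (rUnit S).hom.hom = p₁ S (one y) := rfl
@[simp] theorem lUnit_inv (S : Sp x y) :
  (lUnit S).inv.hom = lift S.l (𝟙 _) (by simp ) := rfl
@[simp] theorem rUnit_inv (S : Sp x y) :
  (rUnit S).inv.hom = lift (𝟙 _) S.r (by simp ) := rfl

/-- The bicategory of spans in a category with pullbacks. -/
noncomputable instance : Bicategory (SpanCat C) where
  Hom x y := Sp x y
  homCategory x y := inferInstanceAs (Category (Sp x y))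
  id x := one x
  comp S T := comp S T
  whiskerLeft S _ _ h := wL S h
  whiskerRight h T := wR h T
  associator := assoc
  leftUnitor := lUnit
  rightUnitor := rUnit
  whiskerLeft_id S T := by refine Span.hom_ext (comp_ext ?_ ?_) <;> simp
  whiskerLeft_comp S _ _ _ f g := by refine Span.hom_ext (comp_ext ?_ ?_) <;> simp
  id_whiskerRight S T := by refine Span.hom_ext (comp_ext ?_ ?_) <;> simp
  comp_whiskerRight f g T := by refine Span.hom_ext (comp_ext ?_ ?_) <;> simp
  id_whiskerLeft f := by
    rw [← Category.assoc, Iso.eq_comp_inv]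
    exact Span.hom_ext (by simp)
  whiskerRight_id f := by
    rw [← Category.assoc, Iso.eq_comp_inv]
    exact Span.hom_ext (by simp)
  comp_whiskerLeft S T _ _ h := by
    rw [← Category.assoc, Iso.eq_comp_inv]
    refine Span.hom_ext (comp_ext ?_ (comp_ext ?_ ?_)) <;> simp
  whiskerRight_comp h S T := by
    rw [Iso.eq_inv_comp]
    refine Span.hom_ext (comp_ext ?_ (comp_ext ?_ ?_)) <;> simp
  whisker_assoc S _ _ f T := by
    rw [← Category.assoc, Iso.eq_comp_inv]
    refine Span.hom_ext (comp_ext ?_ (comp_ext ?_ ?_)) <;> simp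
  whisker_exchange f g := by refine Span.hom_ext (comp_ext ?_ ?_) <;> simp
  pentagon S T U V := by
    refine Span.hom_ext (comp_ext ?_ (comp_ext ?_ (comp_ext ?_ ?_))) <;> simp
  triangle S T := by
    refine Span.hom_ext (comp_ext ?_ ?_) <;> simp

end Sp
end Spans
end PropMonads

namespace PropMonads

open CategoryTheory Bicategory Limits

universe v u

section SpanMon

namespace Sp

variable {x y z : SpanCat MonCat.{u}}

theorem elt_ext (S : Sp x y) (T : Sp y z) {a b : (comp S T).apex}
    (h₁ : p₁ S T a = p₁ S T b) (h₂ : p₂ S T a = p₂ S T b) : a = b :=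
  Types.ext_of_isPullback ((isPullback S T).map (forget MonCat)) h₁ h₂

theorem exists_elt (S : Sp x y) (T : Sp y z) (a : S.apex) (b : T.apex) (h : S.r a = T.l b) :
    ∃ c : (comp S T).apex, p₁ S T c = a ∧ p₂ S T c = b :=
  Types.exists_of_isPullback ((isPullback S T).map (forget MonCat)) a b h

theorem cond_apply (S : Sp x y) (T : Sp y z) (a : (comp S T).apex) :
    S.r (p₁ S T a) = T.l (p₂ S T a) :=
  ConcreteCategory.congr_hom (cond S T) a

theorem l_apply {S T : Sp x y} (f : S ⟶ T) (a : S.apex) : T.l (f.hom a) = S.l a :=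
  ConcreteCategory.congr_hom f.hom_l a

theorem r_apply {S T : Sp x y} (f : S ⟶ T) (a : S.apex) : T.r (f.hom a) = S.r a :=
  ConcreteCategory.congr_hom f.hom_r a

/-- Elements identified in one step by a pair of span morphisms. -/
def Rel {X Y : Sp x y} (f g : X ⟶ Y) (a b : Y.apex) : Prop :=
  ∃ t : X.apex, f.hom t = a ∧ g.hom t = b

theorem comp_apply {X Y Z : Sp x y} (f : X ⟶ Y) (g : Y ⟶ Z) (a : X.apex) :
    (f ≫ g).hom a = g.hom (f.hom a) := rfl

theorem eqvGen_eq {X Y Q : Sp x y} {f g : X ⟶ Y} {q : Y ⟶ Q} (w : f ≫ q = g ≫ q)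
    {a b : Y.apex} (h : Relation.EqvGen (Rel f g) a b) : q.hom a = q.hom b := by
  induction h with
  | rel a b h =>
    obtain ⟨t, rfl, rfl⟩ := h
    rw [← comp_apply, w, comp_apply]
  | refl => rfl
  | symm _ _ _ ih => exact ih.symm
  | trans _ _ _ _ _ h₁ h₂ => exact h₁.trans h₂

theorem eqvGen_l {X Y : Sp x y} {f g : X ⟶ Y} {a b : Y.apex}
    (h : Relation.EqvGen (Rel f g) a b) : Y.l a = Y.l b := by
  induction h with
  | rel a b h =>
    obtain ⟨t, rfl, rfl⟩ := h
    rw [l_apply, l_apply]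
  | refl => rfl
  | symm _ _ _ ih => exact ih.symm
  | trans _ _ _ _ _ h₁ h₂ => exact h₁.trans h₂

theorem eqvGen_r {X Y : Sp x y} {f g : X ⟶ Y} {a b : Y.apex}
    (h : Relation.EqvGen (Rel f g) a b) : Y.r a = Y.r b := by
  induction h with
  | rel a b h =>
    obtain ⟨t, rfl, rfl⟩ := h
    rw [r_apply, r_apply]
  | refl => rfl
  | symm _ _ _ ih => exact ih.symm
  | trans _ _ _ _ _ h₁ h₂ => exact h₁.trans h₂

/-- A surjective span morphism whose kernel is generated by the pair is a coequalizer. -/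
noncomputable def isColimitOfSurjective {X Y Q : Sp x y} {f g : X ⟶ Y} (q : Y ⟶ Q)
    (w : f ≫ q = g ≫ q) (hs : Function.Surjective q.hom)
    (hk : ∀ a b, q.hom a = q.hom b → Relation.EqvGen (Rel f g) a b) :
    IsColimit (Cofork.ofπ q w) :=
  Cofork.IsColimit.mk' _ fun s => by
    have key : ∀ {a b}, q.hom a = q.hom b → s.π.hom a = s.π.hom b :=
      fun h => eqvGen_eq s.condition (hk _ _ h)
    have hσ : ∀ b, q.hom (Function.surjInv hs b) = b := Function.surjInv_eq hs
    have hl : ∀ a, s.π.hom (Function.surjInv hs (q.hom a)) = s.π.hom a := fun a => key (hσ _)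
    let k : Q.apex ⟶ s.pt.apex := MonCat.ofHom
      { toFun := fun b => s.π.hom (Function.surjInv hs b)
        map_one' := by
          have h := hl 1
          rwa [map_one, map_one] at h
        map_mul' := fun a b => by
          obtain ⟨a, rfl⟩ := hs a
          obtain ⟨b, rfl⟩ := hs b
          rw [← map_mul, hl, hl, hl, map_mul] }
    have hk : ∀ a, k (q.hom a) = s.π.hom a := hl
    refine ⟨⟨k, ?_, ?_⟩, ?_, ?_⟩
    · refine ConcreteCategory.hom_ext _ _ fun b => ?_
      obtain ⟨a, rfl⟩ := hs b
      refine (congrArg s.pt.l (hk a)).trans ?_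
      rw [l_apply]; exact (l_apply _ _).symm
    · refine ConcreteCategory.hom_ext _ _ fun b => ?_
      obtain ⟨a, rfl⟩ := hs b
      refine (congrArg s.pt.r (hk a)).trans ?_
      rw [r_apply]; exact (r_apply _ _).symm
    · exact Span.hom_ext (ConcreteCategory.hom_ext _ _ hk)
    · intro m hm
      refine Span.hom_ext (ConcreteCategory.hom_ext _ _ fun b => ?_)
      obtain ⟨a, rfl⟩ := hs b
      refine Eq.trans ?_ (hk a).symm
      rw [← hm]; rfl

/-- The congruence generated by a reflexive pair. -/
def con {X Y : Sp x y} (f g : X ⟶ Y) [IsReflexivePair f g] : Con Y.apex where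
  r := Relation.EqvGen (Rel f g)
  iseqv := Relation.EqvGen.is_equivalence _
  mul' := by
    obtain ⟨s, hf, hg⟩ := IsReflexivePair.common_section f g
    have hf' : ∀ c, f.hom (s.hom c) = c := fun c => by rw [← comp_apply, hf]; rfl
    have hg' : ∀ c, g.hom (s.hom c) = c := fun c => by rw [← comp_apply, hg]; rfl
    have hr : ∀ {a b} c, Relation.EqvGen (Rel f g) a b →
        Relation.EqvGen (Rel f g) (a * c) (b * c) := by
      intro a b c h
      induction h with
      | rel a b h =>
        obtain ⟨t, rfl, rfl⟩ := h
        exact .rel _ _ ⟨t * s.hom c, by rw [map_mul, hf'], by rw [map_mul, hg']⟩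
      | refl => exact .refl _
      | symm _ _ _ ih => exact .symm _ _ ih
      | trans _ _ _ _ _ h₁ h₂ => exact .trans _ _ _ h₁ h₂
    have hl : ∀ {a b} c, Relation.EqvGen (Rel f g) a b →
        Relation.EqvGen (Rel f g) (c * a) (c * b) := by
      intro a b c h
      induction h with
      | rel a b h =>
        obtain ⟨t, rfl, rfl⟩ := h
        exact .rel _ _ ⟨s.hom c * t, by rw [map_mul, hf'], by rw [map_mul, hg']⟩
      | refl => exact .refl _
      | symm _ _ _ ih => exact .symm _ _ ih
      | trans _ _ _ _ _ h₁ h₂ => exact .trans _ _ _ h₁ h₂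
    exact fun {_ _ _ _} h₁ h₂ => .trans _ _ _ (hr _ h₁) (hl _ h₂)

/-- The coequalizer of a reflexive pair of span morphisms: the quotient by the generated
equivalence relation. -/
def coeqObj {X Y : Sp x y} (f g : X ⟶ Y) [IsReflexivePair f g] : Sp x y :=
  mk (A := MonCat.of (con f g).Quotient)
    (MonCat.ofHom ((con f g).lift Y.l.hom fun _ _ h => eqvGen_l h))
    (MonCat.ofHom ((con f g).lift Y.r.hom fun _ _ h => eqvGen_r h))

def coeqπ {X Y : Sp x y} (f g : X ⟶ Y) [IsReflexivePair f g] : Y ⟶ coeqObj f g where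
  hom := MonCat.ofHom (con f g).mk'
  hom_l := rfl
  hom_r := rfl

theorem coeq_surjective {X Y : Sp x y} (f g : X ⟶ Y) [IsReflexivePair f g] :
    Function.Surjective (coeqπ f g).hom := Con.mk'_surjective

theorem coeq_kernel {X Y : Sp x y} (f g : X ⟶ Y) [IsReflexivePair f g] (a b : Y.apex)
    (h : (coeqπ f g).hom a = (coeqπ f g).hom b) : Relation.EqvGen (Rel f g) a b :=
  (Con.eq (con f g)).1 h

theorem coeq_cond {X Y : Sp x y} (f g : X ⟶ Y) [IsReflexivePair f g] :
    f ≫ coeqπ f g = g ≫ coeqπ f g :=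
  Span.hom_ext (ConcreteCategory.hom_ext _ _ fun t =>
    (Con.eq (con f g)).2 (.rel _ _ ⟨t, rfl, rfl⟩))

noncomputable def coeqIsColimit {X Y : Sp x y} (f g : X ⟶ Y) [IsReflexivePair f g] :
    IsColimit (Cofork.ofπ (coeqπ f g) (coeq_cond f g)) :=
  isColimitOfSurjective _ _ (coeq_surjective f g) (coeq_kernel f g)

theorem wL_apply₁ (S : Sp x y) {T T' : Sp y z} (h : T ⟶ T') (a : (comp S T).apex) :
    p₁ S T' ((wL S h).hom a) = p₁ S T a := ConcreteCategory.congr_hom (wL_p₁ S h) a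
theorem wL_apply₂ (S : Sp x y) {T T' : Sp y z} (h : T ⟶ T') (a : (comp S T).apex) :
    p₂ S T' ((wL S h).hom a) = h.hom (p₂ S T a) := ConcreteCategory.congr_hom (wL_p₂ S h) a
theorem wR_apply₁ {S S' : Sp x y} (h : S ⟶ S') (T : Sp y z) (a : (comp S T).apex) :
    p₁ S' T ((wR h T).hom a) = h.hom (p₁ S T a) := ConcreteCategory.congr_hom (wR_p₁ h T) a
theorem wR_apply₂ {S S' : Sp x y} (h : S ⟶ S') (T : Sp y z) (a : (comp S T).apex) :
    p₂ S' T ((wR h T).hom a) = p₂ S T a := ConcreteCategory.congr_hom (wR_p₂ h T) a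

theorem eqvGen_wL (S : Sp x y) {X Y : Sp y z} {f g : X ⟶ Y} {b b' : Y.apex}
    (h : Relation.EqvGen (Rel f g) b b') : ∀ a a' : (comp S Y).apex, p₁ S Y a = p₁ S Y a' →
    p₂ S Y a = b → p₂ S Y a' = b' → Relation.EqvGen (Rel (wL S f) (wL S g)) a a' := by
  induction h with
  | rel b b' h =>
    rintro a a' e₁ rfl rfl
    obtain ⟨t, h₁, h₂⟩ := h
    obtain ⟨c, hc₁, hc₂⟩ := exists_elt S X (p₁ S Y a) t (by rw [cond_apply, ← h₁, l_apply])
    refine .rel _ _ ⟨c, elt_ext _ _ ?_ ?_, elt_ext _ _ ?_ ?_⟩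
    · rw [wL_apply₁, hc₁]
    · rw [wL_apply₂, hc₂, h₁]
    · rw [wL_apply₁, hc₁, e₁]
    · rw [wL_apply₂, hc₂, h₂]
  | refl b =>
    rintro a a' e₁ rfl e₂
    rw [elt_ext _ _ e₁ e₂.symm]
    exact .refl _
  | symm _ _ _ ih => exact fun a a' e₁ e₂ e₃ => .symm _ _ (ih a' a e₁.symm e₃ e₂)
  | trans b m b' h₁ h₂ ih₁ ih₂ =>
    intro a a' e₁ e₂ e₃
    obtain ⟨c, hc₁, hc₂⟩ := exists_elt S Y (p₁ S Y a) m (by rw [cond_apply, e₂, eqvGen_l h₁])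
    exact .trans _ _ _ (ih₁ a c hc₁.symm e₂ hc₂) (ih₂ c a' (hc₁.trans e₁) hc₂ e₃)

theorem eqvGen_wR {X Y : Sp x y} (T : Sp y z) {f g : X ⟶ Y} {b b' : Y.apex}
    (h : Relation.EqvGen (Rel f g) b b') : ∀ a a' : (comp Y T).apex, p₂ Y T a = p₂ Y T a' →
    p₁ Y T a = b → p₁ Y T a' = b' → Relation.EqvGen (Rel (wR f T) (wR g T)) a a' := by
  induction h with
  | rel b b' h =>
    rintro a a' e₁ rfl rfl
    obtain ⟨t, h₁, h₂⟩ := h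
    obtain ⟨c, hc₁, hc₂⟩ := exists_elt X T t (p₂ Y T a) (by rw [← cond_apply, ← h₁, r_apply])
    refine .rel _ _ ⟨c, elt_ext _ _ ?_ ?_, elt_ext _ _ ?_ ?_⟩
    · rw [wR_apply₁, hc₁, h₁]
    · rw [wR_apply₂, hc₂]
    · rw [wR_apply₁, hc₁, h₂]
    · rw [wR_apply₂, hc₂, e₁]
  | refl b =>
    rintro a a' e₁ rfl e₂
    rw [elt_ext _ _ e₂.symm e₁]
    exact .refl _
  | symm _ _ _ ih => exact fun a a' e₁ e₂ e₃ => .symm _ _ (ih a' a e₁.symm e₃ e₂)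
  | trans b m b' h₁ h₂ ih₁ ih₂ =>
    intro a a' e₁ e₂ e₃
    obtain ⟨c, hc₁, hc₂⟩ := exists_elt Y T m (p₂ Y T a) (by rw [← cond_apply, e₂, eqvGen_r h₁])
    exact .trans _ _ _ (ih₁ a c hc₂.symm e₂ hc₁) (ih₂ c a' (hc₂.trans e₁) hc₁ e₃)

theorem wL_comp_eq (S : Sp x y) {X Y Q : Sp y z} {f g : X ⟶ Y} {q : Y ⟶ Q} (w : f ≫ q = g ≫ q) :
    wL S f ≫ wL S q = wL S g ≫ wL S q := by
  have h : ∀ k : X ⟶ Y, wL S k ≫ wL S q = wL S (k ≫ q) := fun k =>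
    Span.hom_ext (comp_ext (by simp) (by simp))
  rw [h, h, w]

theorem wR_comp_eq {X Y Q : Sp x y} (T : Sp y z) {f g : X ⟶ Y} {q : Y ⟶ Q} (w : f ≫ q = g ≫ q) :
    wR f T ≫ wR q T = wR g T ≫ wR q T := by
  have h : ∀ k : X ⟶ Y, wR k T ≫ wR q T = wR (k ≫ q) T := fun k =>
    Span.hom_ext (comp_ext (by simp) (by simp))
  rw [h, h, w]

noncomputable def coeqIsColimitL (S : Sp x y) {X Y : Sp y z} (f g : X ⟶ Y) [IsReflexivePair f g] :
    IsColimit (Cofork.ofπ (wL S (coeqπ f g)) (wL_comp_eq S (coeq_cond f g))) :=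
  isColimitOfSurjective _ _
    (fun b => by
      obtain ⟨c, hc⟩ := coeq_surjective f g (p₂ S (coeqObj f g) b)
      obtain ⟨a, h₁, h₂⟩ := exists_elt S Y (p₁ S (coeqObj f g) b) c (by rw [cond_apply, ← hc, l_apply])
      exact ⟨a, elt_ext _ _ (by rw [wL_apply₁, h₁]) (by rw [wL_apply₂, h₂, hc])⟩)
    (fun a b h => eqvGen_wL S (b := p₂ S Y a) (b' := p₂ S Y b)
      (coeq_kernel f g _ _ (by rw [← wL_apply₂, h, wL_apply₂])) a b
      (by rw [← wL_apply₁ S (coeqπ f g), h, wL_apply₁]) rfl rfl)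

noncomputable def coeqIsColimitR {X Y : Sp x y} (T : Sp y z) (f g : X ⟶ Y) [IsReflexivePair f g] :
    IsColimit (Cofork.ofπ (wR (coeqπ f g) T) (wR_comp_eq T (coeq_cond f g))) :=
  isColimitOfSurjective _ _
    (fun b => by
      obtain ⟨c, hc⟩ := coeq_surjective f g (p₁ (coeqObj f g) T b)
      obtain ⟨a, h₁, h₂⟩ := exists_elt Y T c (p₂ (coeqObj f g) T b) (by rw [← cond_apply, ← hc, r_apply])
      exact ⟨a, elt_ext _ _ (by rw [wR_apply₁, h₁, hc]) (by rw [wR_apply₂, h₂])⟩)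
    (fun a b h => eqvGen_wR T (b := p₁ Y T a) (b' := p₁ Y T b)
      (coeq_kernel f g _ _ (by rw [← wR_apply₁, h, wR_apply₁])) a b
      (by rw [← wR_apply₂ (coeqπ f g) T, h, wR_apply₂]) rfl rfl)

instance : HasStableReflexiveCoequalizers (SpanCat MonCat.{u}) where
  hasReflexiveCoequalizers x y :=
    { has_coeq := fun {X Y} f g _ =>
        HasColimit.mk ⟨_, coeqIsColimit (x := x) (y := y) (X := X) (Y := Y) f g⟩ }
  precomp_preserves {_ _} z S {X Y} f g _ :=
    preservesColimit_of_preserves_colimit_cocone (coeqIsColimit (X := X) (Y := Y) f g)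
      ((isColimitMapCoconeCoforkEquiv (precomp z S) (coeq_cond (X := X) (Y := Y) f g)).symm
        (coeqIsColimitL (X := X) (Y := Y) S f g))
  postcomp_preserves x {_ _} T {X Y} f g _ :=
    preservesColimit_of_preserves_colimit_cocone (coeqIsColimit (X := X) (Y := Y) f g)
      ((isColimitMapCoconeCoforkEquiv (postcomp x T) (coeq_cond (X := X) (Y := Y) f g)).symm
        (coeqIsColimitR (X := X) (Y := Y) T f g))

end Sp
end SpanMon
end PropMonads

namespace PropMonads

open CategoryTheory Bicategory Limits MonoidalCategory

universe u

/-- The natural numbers, as a type in an arbitrary universe. -/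
@[ext]
structure NatOb : Type u where
  n : ℕ

namespace NatOb

/-- The monoid `(ℕ, +, 0)`, written multiplicatively. -/
instance : Monoid NatOb.{u} where
  mul a b := ⟨a.n + b.n⟩
  one := ⟨0⟩
  mul_assoc a b c := NatOb.ext (Nat.add_assoc a.n b.n c.n)
  one_mul a := NatOb.ext (Nat.zero_add a.n)
  mul_one a := NatOb.ext (Nat.add_zero a.n)

end NatOb

/-- A PROP: a small symmetric strict monoidal category whose monoid of objects is `(ℕ, +, 0)`. -/
structure PROP where
  [category : SmallCategory NatOb.{u}]
  [monoidal : MonoidalCategory NatOb.{u}]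
  [symmetric : SymmetricCategory NatOb.{u}]
  tensorUnit_eq : 𝟙_ NatOb.{u} = 1
  tensorObj_eq (X Y : NatOb.{u}) : X ⊗ Y = X * Y
  associator_eq (X Y Z : NatOb.{u}) :
    (α_ X Y Z).hom = eqToHom (by simp only [tensorObj_eq, mul_assoc])
  leftUnitor_eq (X : NatOb.{u}) :
    (λ_ X).hom = eqToHom (by simp only [tensorObj_eq, tensorUnit_eq, one_mul])
  rightUnitor_eq (X : NatOb.{u}) :
    (ρ_ X).hom = eqToHom (by simp only [tensorObj_eq, tensorUnit_eq, mul_one])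

namespace PROP

/-- The objects of a PROP. -/
def Ob (_ : PROP.{u}) : Type u := NatOb.{u}

instance (T : PROP.{u}) : SmallCategory T.Ob := T.category
instance (T : PROP.{u}) : MonoidalCategory T.Ob := T.monoidal
instance (T : PROP.{u}) : SymmetricCategory T.Ob := T.symmetric

/-- The set of all arrows of a PROP. -/
structure Ar (T : PROP.{u}) : Type u where
  {dom cod : T.Ob}
  hom : dom ⟶ cod

variable {T : PROP.{u}}

theorem Ar.mk_eq {A B C D : T.Ob} {f : A ⟶ B} {g : C ⟶ D} {a : A ⟶ C} {b : B ⟶ D}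
    {h₁ : A = C} {h₂ : B = D} (ha : a = eqToHom h₁) (hb : b = eqToHom h₂) (h : f ≫ b = a ≫ g) :
    (⟨f⟩ : T.Ar) = ⟨g⟩ := by
  subst h₁ h₂ ha hb
  simp only [eqToHom_refl, Category.comp_id, Category.id_comp] at h
  rw [h]

/-- The arrows of a PROP form a monoid under the monoidal product. -/
instance : Monoid T.Ar where
  mul f g := ⟨f.hom ⊗ₘ g.hom⟩
  one := ⟨𝟙 (𝟙_ T.Ob)⟩
  mul_assoc f g h :=
    Ar.mk_eq (T.associator_eq f.dom g.dom h.dom) (T.associator_eq f.cod g.cod h.cod)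
      (associator_naturality f.hom g.hom h.hom)
  one_mul f :=
    Ar.mk_eq (T.leftUnitor_eq f.dom) (T.leftUnitor_eq f.cod)
      (show (𝟙 (𝟙_ T.Ob) ⊗ₘ f.hom) ≫ (λ_ f.cod).hom = (λ_ f.dom).hom ≫ f.hom by simp)
  mul_one f :=
    Ar.mk_eq (T.rightUnitor_eq f.dom) (T.rightUnitor_eq f.cod)
      (show (f.hom ⊗ₘ 𝟙 (𝟙_ T.Ob)) ≫ (ρ_ f.cod).hom = (ρ_ f.dom).hom ≫ f.hom by simp)

/-- The graph of composition (in diagrammatic order) on the arrows of a PROP. -/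
inductive IsComp : T.Ar → T.Ar → T.Ar → Prop
  | mk {X Y Z : T.Ob} (f : X ⟶ Y) (g : Y ⟶ Z) : IsComp ⟨f⟩ ⟨g⟩ ⟨f ≫ g⟩

/-- Composition of a composable pair of arrows. -/
def Ar.comp (f g : T.Ar) (h : f.cod = g.dom) : T.Ar := ⟨f.hom ≫ eqToHom h ≫ g.hom⟩

variable (T)

/-- Source, target and identities, as monoid homomorphisms. -/
def domHom : T.Ar →* NatOb.{u} where
  toFun f := f.dom
  map_one' := T.tensorUnit_eq
  map_mul' f g := T.tensorObj_eq f.dom g.dom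

def codHom : T.Ar →* NatOb.{u} where
  toFun f := f.cod
  map_one' := T.tensorUnit_eq
  map_mul' f g := T.tensorObj_eq f.cod g.cod

def idHom : NatOb.{u} →* T.Ar where
  toFun X := ⟨𝟙 (show T.Ob from X)⟩
  map_one' := by
    rw [← T.tensorUnit_eq]; rfl
  map_mul' X Y := by
    rw [← T.tensorObj_eq]
    exact congrArg Ar.mk (id_tensorHom_id (C := T.Ob) X Y).symm

/-- The monoid `(ℕ, +, 0)` as an object of the bicategory of spans of monoids. -/
def natMon : SpanCat MonCat.{u} := ⟨MonCat.of NatOb.{u}⟩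

/-- The span `ℕ ← Ar(T) → ℕ` of monoids. -/
def span : natMon.{u} ⟶ natMon.{u} :=
  Sp.mk (x := natMon) (y := natMon) (A := MonCat.of T.Ar)
    (MonCat.ofHom T.domHom) (MonCat.ofHom T.codHom)


variable {T}

theorem Ar.id_comp (f : T.Ar) (X : NatOb.{u}) (h : X = f.dom) : (T.idHom X).comp f h = f := by
  subst h
  obtain ⟨f⟩ := f
  simp [Ar.comp, idHom]

theorem Ar.comp_id (f : T.Ar) (X : NatOb.{u}) (h : f.cod = X) : f.comp (T.idHom X) h = f := by
  subst h
  obtain ⟨f⟩ := f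
  simp [Ar.comp, idHom]

theorem Ar.comp_assoc (f g k : T.Ar) (h₁ : f.cod = g.dom) (h₂ : g.cod = k.dom) :
    (f.comp g h₁).comp k h₂ = f.comp (g.comp k h₂) h₁ := by
  simp [Ar.comp]

theorem Ar.mul_comp_mul (f f' g g' : T.Ar) (h : f.cod = g.dom) (h' : f'.cod = g'.dom)
    (hm : (f * f').cod = (g * g').dom) :
    (f * f').comp (g * g') hm = f.comp g h * f'.comp g' h' := by
  obtain ⟨f⟩ := f
  obtain ⟨f'⟩ := f'
  obtain ⟨g⟩ := g
  obtain ⟨g'⟩ := g'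
  dsimp only at h h'
  subst h h'
  change Ar.mk ((f ⊗ₘ f') ≫ 𝟙 _ ≫ (g ⊗ₘ g')) = Ar.mk ((f ≫ 𝟙 _ ≫ g) ⊗ₘ (f' ≫ 𝟙 _ ≫ g'))
  simp

theorem Ar.one_comp_one (h : (1 : T.Ar).cod = (1 : T.Ar).dom) :
    (1 : T.Ar).comp 1 h = 1 := by
  change Ar.mk (𝟙 (𝟙_ T.Ob) ≫ 𝟙 (𝟙_ T.Ob) ≫ 𝟙 (𝟙_ T.Ob)) = Ar.mk (𝟙 (𝟙_ T.Ob))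
  rw [Category.comp_id, Category.comp_id]

theorem Ar.comp_congr {f f' g g' : T.Ar} (hf : f = f') (hg : g = g') (h : f.cod = g.dom) :
    f.comp g h = f'.comp g' (by rw [← hf, ← hg, h]) := by
  subst hf hg
  rfl

theorem cod_eq_dom (x : (Sp.comp T.span T.span).apex) :
    (Sp.p₁ T.span T.span x : T.Ar).cod = (Sp.p₂ T.span T.span x : T.Ar).dom :=
  Sp.cond_apply T.span T.span x

variable (T)

/-- The unit of the monad: identities. -/
def unit : 𝟙 natMon.{u} ⟶ T.span :=
  show Sp.one natMon ⟶ T.span from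
  { hom := MonCat.ofHom T.idHom
    hom_l := rfl
    hom_r := rfl }

/-- The multiplication of the monad: composition. -/
noncomputable def mult : T.span ≫ T.span ⟶ T.span :=
  show Sp.comp T.span T.span ⟶ T.span from
  { hom := MonCat.ofHom
      { toFun := fun x => Ar.comp (Sp.p₁ T.span T.span x) (Sp.p₂ T.span T.span x) (cod_eq_dom x)
        map_one' := by
          exact (Ar.comp_congr (map_one (Sp.p₁ T.span T.span).hom)
            (map_one (Sp.p₂ T.span T.span).hom) _).trans (Ar.one_comp_one _)
        map_mul' := fun x y => by
          exact (Ar.comp_congr (map_mul (Sp.p₁ T.span T.span).hom x y)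
            (map_mul (Sp.p₂ T.span T.span).hom x y) _).trans
              (Ar.mul_comp_mul _ _ _ _ (cod_eq_dom x) (cod_eq_dom y) _) }
    hom_l := rfl
    hom_r := rfl }

theorem mult_apply (x : (Sp.comp T.span T.span).apex) :
    T.mult.hom x = Ar.comp (Sp.p₁ T.span T.span x) (Sp.p₂ T.span T.span x) (cod_eq_dom x) := rfl

/-- A PROP (indeed any strict monoidal category) is a monad in spans of monoids. -/
noncomputable def monad : MonadOn T.span where
  η := T.unit
  μ := T.mult
  η_μ := by
    refine Span.hom_ext (ConcreteCategory.hom_ext _ _ fun x => ?_)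
    let I : Sp natMon natMon := Sp.one natMon
    let x' : (Sp.comp I T.span).apex := x
    change T.mult.hom ((Sp.wR (S := I) T.unit T.span).hom x') = Sp.p₂ I T.span x'
    rw [mult_apply]
    exact (Ar.comp_congr (Sp.wR_apply₁ (S := I) T.unit T.span x')
      (Sp.wR_apply₂ (S := I) T.unit T.span x') _).trans
        (Ar.id_comp _ _ (Sp.cond_apply I T.span x'))
  μ_η := by
    refine Span.hom_ext (ConcreteCategory.hom_ext _ _ fun x => ?_)
    let I : Sp natMon natMon := Sp.one natMon
    let x' : (Sp.comp T.span I).apex := x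
    change T.mult.hom ((Sp.wL (T := I) T.span T.unit).hom x') = Sp.p₁ T.span I x'
    rw [mult_apply]
    exact (Ar.comp_congr (Sp.wL_apply₁ (T := I) T.span T.unit x')
      (Sp.wL_apply₂ (T := I) T.span T.unit x') _).trans
        (Ar.comp_id _ _ (Sp.cond_apply T.span I x'))
  assoc := by
    refine Span.hom_ext (ConcreteCategory.hom_ext _ _ fun x => ?_)
    let S : Sp natMon natMon := T.span
    let m : Sp.comp S S ⟶ S := T.mult
    let x' : (Sp.comp (Sp.comp S S) S).apex := x
    change m.hom ((Sp.wR m S).hom x') = m.hom ((Sp.wL S m).hom ((Sp.assoc S S S).hom.hom x'))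
    have e₁ : Sp.p₁ S S ((Sp.wR m S).hom x') = m.hom (Sp.p₁ (Sp.comp S S) S x') :=
      Sp.wR_apply₁ m S x'
    have e₂ : Sp.p₂ S S ((Sp.wR m S).hom x') = Sp.p₂ (Sp.comp S S) S x' := Sp.wR_apply₂ m S x'
    have a₁ : Sp.p₁ S (Sp.comp S S) ((Sp.assoc S S S).hom.hom x') =
        Sp.p₁ S S (Sp.p₁ (Sp.comp S S) S x') :=
      ConcreteCategory.congr_hom (Sp.assoc_hom_p₁ S S S) x'
    have a₂ : Sp.p₁ S S (Sp.p₂ S (Sp.comp S S) ((Sp.assoc S S S).hom.hom x')) =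
        Sp.p₂ S S (Sp.p₁ (Sp.comp S S) S x') := by
      have := ConcreteCategory.congr_hom (congrArg (· ≫ Sp.p₁ S S) (Sp.assoc_hom_p₂ S S S)) x'
      simp only [Sp.lift_p₁] at this
      exact this
    have a₃ : Sp.p₂ S S (Sp.p₂ S (Sp.comp S S) ((Sp.assoc S S S).hom.hom x')) =
        Sp.p₂ (Sp.comp S S) S x' := by
      have := ConcreteCategory.congr_hom (congrArg (· ≫ Sp.p₂ S S) (Sp.assoc_hom_p₂ S S S)) x'
      simp only [Sp.lift_p₂] at this
      exact this
    have e₃ := Sp.wL_apply₁ S m ((Sp.assoc S S S).hom.hom x')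
    have e₄ := Sp.wL_apply₂ S m ((Sp.assoc S S S).hom.hom x')
    have m₁ := T.mult_apply (Sp.p₁ (Sp.comp S S) S x')
    have m₂ := T.mult_apply (Sp.p₂ S (Sp.comp S S) ((Sp.assoc S S S).hom.hom x'))
    refine (T.mult_apply _).trans (Eq.trans ?_ (T.mult_apply _).symm)
    refine (Ar.comp_congr (e₁.trans m₁) e₂ _).trans ?_
    refine Eq.trans ?_ (Ar.comp_congr (e₃.trans a₁)
      (e₄.trans (m₂.trans (Ar.comp_congr a₂ a₃ _))) _).symm
    exact Ar.comp_assoc _ _ _ _ _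

/-- A PROP as an object of the bicategory of bimodules in spans of monoids. -/
noncomputable def toMod : ModCat (SpanCat MonCat.{u}) := ⟨natMon, T.span, T.monad⟩

end PROP
end PropMonads

namespace PropMonads

open CategoryTheory Bicategory Limits MonoidalCategory

universe u

namespace PermSum

/-- The sum of two bijections, acting on the first and on the last elements respectively. -/
def sum {a b c d : ℕ} (f : Fin a ≃ Fin b) (g : Fin c ≃ Fin d) : Fin (a + c) ≃ Fin (b + d) :=
  finSumFinEquiv.symm.trans ((f.sumCongr g).trans finSumFinEquiv)

variable {a b c d a' b' c' d' : ℕ}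

@[simp] theorem sum_castAdd (f : Fin a ≃ Fin b) (g : Fin c ≃ Fin d) (i : Fin a) :
    sum f g (Fin.castAdd c i) = Fin.castAdd d (f i) := by
  simp [sum]

@[simp] theorem sum_natAdd (f : Fin a ≃ Fin b) (g : Fin c ≃ Fin d) (i : Fin c) :
    sum f g (Fin.natAdd a i) = Fin.natAdd b (g i) := by
  simp [sum]

theorem ext_sum {α : Type*} {f g : Fin (a + b) ≃ α}
    (h₁ : ∀ i : Fin a, f (Fin.castAdd b i) = g (Fin.castAdd b i))
    (h₂ : ∀ i : Fin b, f (Fin.natAdd a i) = g (Fin.natAdd a i)) : f = g :=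
  Equiv.ext fun i => Fin.addCases (motive := fun i => f i = g i) h₁ h₂ i

theorem ext_sum₃ {α : Type*} {f g : Fin (a + b + c) ≃ α}
    (h₁ : ∀ i : Fin a, f (Fin.castAdd c (Fin.castAdd b i)) = g (Fin.castAdd c (Fin.castAdd b i)))
    (h₂ : ∀ i : Fin b, f (Fin.castAdd c (Fin.natAdd a i)) = g (Fin.castAdd c (Fin.natAdd a i)))
    (h₃ : ∀ i : Fin c, f (Fin.natAdd (a + b) i) = g (Fin.natAdd (a + b) i)) : f = g :=
  ext_sum (fun i => Fin.addCases
    (motive := fun i => f (Fin.castAdd c i) = g (Fin.castAdd c i)) h₁ h₂ i) h₃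

theorem sum_refl : sum (Equiv.refl (Fin a)) (Equiv.refl (Fin b)) = Equiv.refl (Fin (a + b)) :=
  ext_sum (by simp) (by simp)

theorem sum_finCongr (h : a = b) (h' : c = d) :
    sum (finCongr h) (finCongr h') = finCongr (by rw [h, h']) := by
  subst h h'
  exact sum_refl

theorem sum_trans (f : Fin a ≃ Fin b) (g : Fin b ≃ Fin c) (f' : Fin a' ≃ Fin b')
    (g' : Fin b' ≃ Fin c') :
    sum (f.trans g) (f'.trans g') = (sum f f').trans (sum g g') :=
  ext_sum (by simp) (by simp)

theorem cast_assoc₁ (h : a + b + c = a + (b + c)) (i : Fin a) :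
    Fin.cast h (Fin.castAdd c (Fin.castAdd b i)) = Fin.castAdd (b + c) i := rfl

theorem cast_assoc₂ (h : a + b + c = a + (b + c)) (i : Fin b) :
    Fin.cast h (Fin.castAdd c (Fin.natAdd a i)) = Fin.natAdd a (Fin.castAdd c i) := rfl

theorem cast_assoc₃ (h : a + b + c = a + (b + c)) (i : Fin c) :
    Fin.cast h (Fin.natAdd (a + b) i) = Fin.natAdd a (Fin.natAdd b i) :=
  Fin.ext (Nat.add_assoc _ _ _)

theorem sum_assoc (f : Fin a ≃ Fin a') (g : Fin b ≃ Fin b') (h : Fin c ≃ Fin c') :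
    (sum (sum f g) h).trans (finCongr (Nat.add_assoc a' b' c')) =
      (finCongr (Nat.add_assoc a b c)).trans (sum f (sum g h)) :=
  ext_sum₃ (by simp [cast_assoc₁]) (by simp [cast_assoc₂]) (by simp [cast_assoc₃])

theorem zero_sum (f : Fin a ≃ Fin b) :
    (sum (Equiv.refl (Fin 0)) f).trans (finCongr (Nat.zero_add b)) =
      (finCongr (Nat.zero_add a)).trans f := by
  refine ext_sum (fun i => i.elim0) (fun i => ?_)
  have h : ∀ {k : ℕ} (j : Fin k), Fin.cast (Nat.zero_add k) (Fin.natAdd 0 j) = j :=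
    fun j => Fin.ext (Nat.zero_add _)
  simp only [Equiv.trans_apply, sum_natAdd, finCongr_apply, h]

theorem sum_zero (f : Fin a ≃ Fin b) :
    (sum f (Equiv.refl (Fin 0))).trans (finCongr (Nat.add_zero b)) =
      (finCongr (Nat.add_zero a)).trans f := by
  refine ext_sum (fun i => ?_) (fun i => i.elim0)
  simp only [Equiv.trans_apply, sum_castAdd, finCongr_apply]
  rfl

theorem sum_flip (f : Fin a ≃ Fin b) (g : Fin c ≃ Fin d) :
    (sum f g).trans finAddFlip = finAddFlip.trans (sum g f) :=
  ext_sum (by simp) (by simp)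

theorem flip_flip : (finAddFlip (m := a) (n := b)).trans finAddFlip = Equiv.refl _ :=
  ext_sum (by simp) (by simp)

theorem hexagon :
    (finCongr (Nat.add_assoc a b c)).trans
      (finAddFlip.trans (finCongr (Nat.add_assoc b c a))) =
    (sum finAddFlip (Equiv.refl (Fin c))).trans
      ((finCongr (Nat.add_assoc b a c)).trans (sum (Equiv.refl (Fin b)) finAddFlip)) :=
  ext_sum₃ (by simp [cast_assoc₁, cast_assoc₂, cast_assoc₃])
    (by simp [cast_assoc₁, cast_assoc₂])
    (by simp [cast_assoc₂, cast_assoc₃])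

theorem ext_sum₃' {α : Type*} {f g : Fin (a + (b + c)) ≃ α}
    (h₁ : ∀ i : Fin a, f (Fin.castAdd (b + c) i) = g (Fin.castAdd (b + c) i))
    (h₂ : ∀ i : Fin b, f (Fin.natAdd a (Fin.castAdd c i)) = g (Fin.natAdd a (Fin.castAdd c i)))
    (h₃ : ∀ i : Fin c, f (Fin.natAdd a (Fin.natAdd b i)) = g (Fin.natAdd a (Fin.natAdd b i))) :
    f = g :=
  ext_sum h₁ (fun i => Fin.addCases
    (motive := fun i => f (Fin.natAdd a i) = g (Fin.natAdd a i)) h₂ h₃ i)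

theorem cast_assoc₁' (h : a + (b + c) = a + b + c) (i : Fin a) :
    Fin.cast h (Fin.castAdd (b + c) i) = Fin.castAdd c (Fin.castAdd b i) := rfl

theorem cast_assoc₂' (h : a + (b + c) = a + b + c) (i : Fin b) :
    Fin.cast h (Fin.natAdd a (Fin.castAdd c i)) = Fin.castAdd c (Fin.natAdd a i) := rfl

theorem cast_assoc₃' (h : a + (b + c) = a + b + c) (i : Fin c) :
    Fin.cast h (Fin.natAdd a (Fin.natAdd b i)) = Fin.natAdd (a + b) i :=
  Fin.ext (Nat.add_assoc _ _ _).symm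

theorem hexagon' :
    (finCongr (Nat.add_assoc a b c).symm).trans
      (finAddFlip.trans (finCongr (Nat.add_assoc c a b).symm)) =
    (sum (Equiv.refl (Fin a)) finAddFlip).trans
      ((finCongr (Nat.add_assoc a c b).symm).trans (sum finAddFlip (Equiv.refl (Fin b)))) :=
  ext_sum₃' (by simp [cast_assoc₁', cast_assoc₂']) (by simp [cast_assoc₂', cast_assoc₃'])
    (by simp [cast_assoc₁', cast_assoc₂', cast_assoc₃'])

theorem pentagon :
    (sum (finCongr (Nat.add_assoc a b c)) (Equiv.refl (Fin d))).trans
      ((finCongr (Nat.add_assoc a (b + c) d)).trans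
        (sum (Equiv.refl (Fin a)) (finCongr (Nat.add_assoc b c d)))) =
    (finCongr (Nat.add_assoc (a + b) c d)).trans (finCongr (Nat.add_assoc a b (c + d))) := by
  rw [show sum (finCongr (Nat.add_assoc a b c)) (Equiv.refl (Fin d)) = _ from
      sum_finCongr (Nat.add_assoc a b c) rfl,
    show sum (Equiv.refl (Fin a)) (finCongr (Nat.add_assoc b c d)) = _ from
      sum_finCongr rfl (Nat.add_assoc b c d)]
  rfl

theorem triangle :
    (finCongr (Nat.add_assoc a 0 b)).trans
      (sum (Equiv.refl (Fin a)) (finCongr (Nat.zero_add b))) =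
    sum (finCongr (Nat.add_zero a)) (Equiv.refl (Fin b)) := by
  rw [show sum (Equiv.refl (Fin a)) (finCongr (Nat.zero_add b)) = _ from
      sum_finCongr rfl (Nat.zero_add b),
    show sum (finCongr (Nat.add_zero a)) (Equiv.refl (Fin b)) = _ from
      sum_finCongr (Nat.add_zero a) rfl]
  rfl

end PermSum

/-- The objects of the PROP of permutations. -/
def PermOb : Type u := NatOb.{u}

namespace PermOb

open PermSum

/-- An arrow `m ⟶ n` of the PROP of permutations is a bijection from `{0, …, m - 1}` to
`{0, …, n - 1}`; there is none unless `m = n`. -/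
@[ext]
structure Hom (X Y : PermOb.{u}) : Type u where
  equiv : Fin (NatOb.n X) ≃ Fin (NatOb.n Y)

instance : SmallCategory PermOb.{u} where
  Hom := Hom
  id X := ⟨Equiv.refl _⟩
  comp f g := ⟨f.equiv.trans g.equiv⟩

/-- Relabelling along an equality of natural numbers. -/
def castIso {X Y : PermOb.{u}} (h : NatOb.n X = NatOb.n Y) : X ≅ Y where
  hom := ⟨finCongr h⟩
  inv := ⟨finCongr h.symm⟩

theorem castIso_eq {X Y : PermOb.{u}} (h : X = Y) (h' : NatOb.n X = NatOb.n Y) :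
    (castIso h').hom = eqToHom h := by
  subst h
  rfl

instance : MonoidalCategoryStruct PermOb.{u} where
  tensorObj X Y := (⟨NatOb.n X + NatOb.n Y⟩ : NatOb.{u})
  tensorUnit := (⟨0⟩ : NatOb.{u})
  tensorHom f g := ⟨sum f.equiv g.equiv⟩
  whiskerLeft X _ _ f := ⟨sum (Equiv.refl (Fin (NatOb.n X))) f.equiv⟩
  whiskerRight f Y := ⟨sum f.equiv (Equiv.refl (Fin (NatOb.n Y)))⟩
  associator X Y Z := castIso (Nat.add_assoc (NatOb.n X) (NatOb.n Y) (NatOb.n Z))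
  leftUnitor X := castIso (Nat.zero_add (NatOb.n X))
  rightUnitor X := castIso (Nat.add_zero (NatOb.n X))

instance : MonoidalCategory PermOb.{u} where
  tensorHom_def f g := Hom.ext (sum_trans f.equiv (Equiv.refl _) (Equiv.refl _) g.equiv)
  id_tensorHom_id _ _ := Hom.ext sum_refl
  tensorHom_comp_tensorHom f g h k :=
    Hom.ext (sum_trans f.equiv h.equiv g.equiv k.equiv).symm
  whiskerLeft_id _ _ := Hom.ext sum_refl
  id_whiskerRight _ _ := Hom.ext sum_refl
  associator_naturality f g h := Hom.ext (sum_assoc f.equiv g.equiv h.equiv)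
  leftUnitor_naturality f := Hom.ext (zero_sum f.equiv)
  rightUnitor_naturality f := Hom.ext (sum_zero f.equiv)
  pentagon _ _ _ _ := Hom.ext pentagon
  triangle _ _ := Hom.ext triangle

/-- The symmetry exchanges the block of the first and the block of the last elements. -/
def swap (X Y : PermOb.{u}) : X ⊗ Y ≅ Y ⊗ X where
  hom := ⟨finAddFlip (m := NatOb.n X) (n := NatOb.n Y)⟩
  inv := ⟨finAddFlip (m := NatOb.n Y) (n := NatOb.n X)⟩
  hom_inv_id := Hom.ext flip_flip
  inv_hom_id := Hom.ext flip_flip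

instance : SymmetricCategory PermOb.{u} where
  braiding := swap
  braiding_naturality_right X _ _ f := Hom.ext (sum_flip (Equiv.refl (Fin (NatOb.n X))) f.equiv)
  braiding_naturality_left f Z := Hom.ext (sum_flip f.equiv (Equiv.refl (Fin (NatOb.n Z))))
  hexagon_forward _ _ _ := Hom.ext hexagon
  hexagon_reverse _ _ _ := Hom.ext hexagon'
  symmetry _ _ := Hom.ext flip_flip

end PermOb

namespace PROP

/-- The PROP of permutations. -/
def perm : PROP.{u} where
  category := inferInstanceAs (SmallCategory PermOb.{u})
  monoidal := inferInstanceAs (MonoidalCategory PermOb.{u})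
  symmetric := inferInstanceAs (SymmetricCategory PermOb.{u})
  tensorUnit_eq := rfl
  tensorObj_eq _ _ := rfl
  associator_eq _ _ _ := PermOb.castIso_eq _ _
  leftUnitor_eq _ := PermOb.castIso_eq _ _
  rightUnitor_eq _ := PermOb.castIso_eq _ _

/-- A morphism of PROPs: an identity-on-objects strict symmetric monoidal functor. -/
@[ext]
structure Hom (S T : PROP.{u}) where
  map {X Y : NatOb.{u}} : Quiver.Hom (V := S.Ob) X Y → Quiver.Hom (V := T.Ob) X Y
  map_id (X : S.Ob) : map (𝟙 X) = 𝟙 (show T.Ob from X)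
  map_comp {X Y Z : S.Ob} (f : X ⟶ Y) (g : Y ⟶ Z) : map (f ≫ g) = map f ≫ map g
  map_tensor {X Y Z W : S.Ob} (f : X ⟶ Y) (g : Z ⟶ W) :
    (⟨map (f ⊗ₘ g)⟩ : T.Ar) = ⟨map f ⊗ₘ map g⟩
  map_braiding (X Y : NatOb.{u}) :
    (⟨map (BraidedCategory.braiding (C := S.Ob) X Y).hom⟩ : T.Ar) =
      ⟨(BraidedCategory.braiding (C := T.Ob) X Y).hom⟩

/-- The action of a morphism of PROPs on the set of all arrows. -/
def Hom.ar {S T : PROP.{u}} (F : Hom S T) (f : S.Ar) : T.Ar := ⟨F.map f.hom⟩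

/-- A bimodule over the PROP of permutations whose underlying 1-cell is the span of a PROP `T`, as
an endo-1-cell in the bicategory of bimodules. -/
noncomputable def bimod (T : PROP.{u}) (A : BimodStr perm.{u}.toMod perm.{u}.toMod T.span) :
    perm.{u}.toMod ⟶ perm.{u}.toMod :=
  show Bimod perm.{u}.toMod perm.{u}.toMod from ⟨T.span, A⟩

/-- The map `Ar(S) ×_ℕ Ar(T) → Ar(U)` given by a 2-cell from a composite of spans. -/
noncomputable def onArrows {S T U : PROP.{u}} (k : S.span ≫ T.span ⟶ U.span)
    (x : (Sp.comp S.span T.span).apex) : U.Ar :=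
  let k' : Sp.comp S.span T.span ⟶ U.span := k
  k'.hom x

/-- The map `Ar(T) ×_ℕ Ar(T) → Ar(T)` given by a 2-cell from the composite of the bimodule with
itself, by restriction along the quotient 2-cell from the composite of spans. -/
noncomputable def onPairs {T : PROP.{u}} {A : BimodStr perm.{u}.toMod perm.{u}.toMod T.span}
    (m : T.bimod A ≫ T.bimod A ⟶ T.bimod A) (x : (Sp.comp T.span T.span).apex) : T.Ar :=
  let M : Bimod perm.{u}.toMod perm.{u}.toMod := ⟨T.span, A⟩
  let m' : Bimod.tensor M M ⟶ M := m
  let k : T.span ≫ T.span ⟶ T.span := Bimod.π M M ≫ m'.hom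
  onArrows k x

/-- The map `Ar(P) → Ar(T)` given by a 2-cell from the identity 1-cell. -/
noncomputable def onPerm {T : PROP.{u}} {A : BimodStr perm.{u}.toMod perm.{u}.toMod T.span}
    (e : 𝟙 perm.{u}.toMod ⟶ T.bimod A) (p : perm.{u}.Ar) : T.Ar :=
  let M : Bimod perm.{u}.toMod perm.{u}.toMod := ⟨T.span, A⟩
  let e' : Bimod.regular perm.{u}.toMod ⟶ M := e
  let k : perm.{u}.span ⟶ T.span := e'.hom
  k.hom p

/-- The two components of an element of `Ar(S) ×_ℕ Ar(T)`, the apex of the composite span. -/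
noncomputable def fst {S T : PROP.{u}} (x : (Sp.comp S.span T.span).apex) : S.Ar :=
  Sp.p₁ S.span T.span x

noncomputable def snd {S T : PROP.{u}} (x : (Sp.comp S.span T.span).apex) : T.Ar :=
  Sp.p₂ S.span T.span x

end PROP

end PropMonads

universe u

open CategoryTheory PropMonads

/-! The statement has two independent halves.

The first is the initiality of `P`. A permutation `σ` of `n + 1` elements has a normal form: permute
the last `n` elements by `tail σ`, then move the first element to place `σ 0`. Reading this recipe
in `T`, with the symmetry of `1` and `σ 0` for the move, defines `ofPerm` by recursion on `n`, so
there is no well-definedness to check. Functoriality is then the real content. Adjacent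
transpositions generate the symmetric group as a monoid, hence it suffices to see how a normal form
changes when one adjacent transposition is appended (`ofPerm_trans_adjSwap`). There are four
positions of the transposition relative to `σ 0`, and they are settled by the hexagon, its
combination with the involutivity of the symmetry, naturality, and the interchange law. Only
generation by transpositions is needed, not the Coxeter presentation. Compatibility with `⊕` is
checked on the same generators (`ofPerm_sum`), and the symmetries follow from the one on `1 ⊕ 1` by
the hexagons (`map_swap`). Uniqueness holds because every arrow of `P` is a composite of arrows `id
⊕ swap ⊕ id`, with `swap` the symmetry of `1` and `1`, and a PROP morphism has no choice on these
(`eq_ofAr`).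

The second half is formal and holds in every bicategory with stable reflexive coequalizers:
restriction of scalars along a morphism of monads `F → t` makes `t` an `F`-`F`-bimodule, and by
associativity the multiplication of `t` is balanced over `F`, so it descends to the coequalizer `t ⊗
t` over `F`. The quotient 2-cells stay epi after whiskering, so every law can be tested before
passing to the quotient: the associativity law becomes that of `t`, and the unit laws become the
definitions of the two actions (`bimodMonad`).

The halves meet in `Hom.monadHom`: a morphism of PROPs is a morphism of the corresponding monads in
spans of monoids. -/

namespace PropMonads

open CategoryTheory Bicategory Limits

universe w v

/-! ### Restriction of scalars along a morphism of monads. -/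

section RestrictionOfScalars

variable {B : Type u} [Bicategory.{w, v} B] {F : ModCat B}

/-- A morphism of monads over the identity of the base. -/
structure MonadHom (F : ModCat B) {t : F.base ⟶ F.base} (M : MonadOn t) where
  hom : F.cell ⟶ t
  η_hom : F.monad.η ≫ hom = M.η
  μ_hom : F.monad.μ ≫ hom = hom ▷ F.cell ≫ t ◁ hom ≫ M.μ

namespace MonadHom

variable {t : F.base ⟶ F.base} {M : MonadOn t} (φ : MonadHom F M)

/-- The bimodule structure on the target of a morphism of monads. -/
@[simps]
def bimodStr : BimodStr F F t where
  l := φ.hom ▷ t ≫ M.μ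
  r := t ◁ φ.hom ≫ M.μ
  unit_l := by rw [← comp_whiskerRight_assoc, φ.η_hom, M.η_μ]
  -- The action axiom is multiplicativity of `φ` followed by associativity of `M`; interchange
  -- brings the two copies of `φ` into the same order.
  mul_l := by
    rw [← comp_whiskerRight_assoc, φ.μ_hom]
    simp only [comp_whiskerRight, Category.assoc, M.assoc, whiskerLeft_comp,
      whisker_exchange_assoc]
    simp
  unit_r := by rw [← whiskerLeft_comp_assoc, φ.η_hom, M.μ_η]
  mul_r := by
    rw [← whiskerLeft_comp_assoc, φ.μ_hom]
    simp only [comp_whiskerRight, Category.assoc, whiskerLeft_comp,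
      ← whisker_exchange_assoc, M.assoc]
    simp
  -- Both sides send `(p, x, q)` to `φ(p) x φ(q)`, so only associativity of `M` enters.
  middle := by
    simp only [comp_whiskerRight, Category.assoc, whiskerLeft_comp,
      ← whisker_exchange_assoc, M.assoc]
    simp [whisker_exchange_assoc]

/-- The target of a morphism of monads as a bimodule over the source. -/
abbrev toBimod : Bimod F F := ⟨t, φ.bimodStr⟩

/-- A morphism of monads as a morphism from the regular bimodule. -/
def unitHom : Bimod.regular F ⟶ φ.toBimod where
  hom := φ.hom
  l_hom := by
    change F.monad.μ ≫ φ.hom = F.cell ◁ φ.hom ≫ φ.hom ▷ t ≫ M.μ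
    rw [φ.μ_hom, whisker_exchange_assoc]
  -- The order of whiskerings in `μ_hom` already matches the right action; the left action needed
  -- one interchange.
  r_hom := φ.μ_hom

/-- Associativity `(x φ(p)) y = x (φ(p) y)`. This is the coequalizer condition that lets `M.μ`
descend to the composite over `F`. -/
theorem mult_balanced :
    φ.toBimod.r ▷ t ≫ M.μ = (α_ t F.cell t).hom ≫ t ◁ φ.toBimod.l ≫ M.μ := by
  change (t ◁ φ.hom ≫ M.μ) ▷ t ≫ M.μ = (α_ _ _ _).hom ≫ t ◁ (φ.hom ▷ t ≫ M.μ) ≫ M.μ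
  simp [M.assoc]

variable [HasStableReflexiveCoequalizers B]

/-- The multiplication of the target, on the composite of bimodules. -/
noncomputable def multCell : (Bimod.tensor φ.toBimod φ.toBimod).X ⟶ t :=
  Bimod.desc φ.toBimod φ.toBimod M.μ φ.mult_balanced

theorem π_multCell : Bimod.π φ.toBimod φ.toBimod ≫ φ.multCell = M.μ :=
  Bimod.π_desc φ.toBimod φ.toBimod M.μ φ.mult_balanced

/-- The multiplication of the target, as a morphism of bimodules. -/
noncomputable def multHom : Bimod.tensor φ.toBimod φ.toBimod ⟶ φ.toBimod where
  hom := φ.multCell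
  l_hom := by
    -- Whiskering preserves the coequalizer, so the whiskered quotient is still epi and the equation
    -- may be tested on representatives, where it is associativity of `M`.
    rw [← cancel_epi (F.cell ◁ Bimod.π φ.toBimod φ.toBimod), Bimod.π_tensor_l_assoc,
      π_multCell, ← whiskerLeft_comp_assoc, π_multCell]
    change (α_ _ _ _).inv ≫ (φ.hom ▷ t ≫ M.μ) ▷ t ≫ M.μ = F.cell ◁ M.μ ≫ φ.hom ▷ t ≫ M.μ
    simp [M.assoc, whisker_exchange_assoc]
  r_hom := by
    rw [← cancel_epi (Bimod.π φ.toBimod φ.toBimod ▷ F.cell), Bimod.π_tensor_r_assoc,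
      π_multCell, ← comp_whiskerRight_assoc, π_multCell]
    change (α_ _ _ _).hom ≫ t ◁ (t ◁ φ.hom ≫ M.μ) ≫ M.μ = M.μ ▷ F.cell ≫ t ◁ φ.hom ≫ M.μ
    rw [← whisker_exchange_assoc, M.assoc]
    simp

theorem π_multHom : Bimod.π φ.toBimod φ.toBimod ≫ φ.multHom.hom = M.μ :=
  φ.π_multCell

/-- A morphism of monads makes its target a monad in the bicategory of bimodules. -/
noncomputable def bimodMonad :
    MonadOn (B := ModCat B) (a := F) (show F ⟶ F from φ.toBimod) where
  η := φ.unitHom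
  μ := φ.multHom
  η_μ := by
    -- The unitors of the bimodule bicategory are induced by the actions, so before the quotient
    -- each unit law reads "apply `φ`, then multiply, equals the action", which is the definition of
    -- the action. The unit laws of `M` were already spent in `bimodStr`.
    refine Bimod.tensor_hom_ext (M := Bimod.regular F) (N := φ.toBimod) (P := φ.toBimod) ?_
    change Bimod.π _ _ ≫ (Bimod.wR φ.unitHom φ.toBimod).hom ≫ φ.multHom.hom =
      Bimod.π _ _ ≫ (Bimod.lUnit φ.toBimod).hom.hom
    rw [Bimod.π_wR_assoc, π_multHom, Bimod.π_lUnit_hom]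
    rfl
  μ_η := by
    refine Bimod.tensor_hom_ext (M := φ.toBimod) (N := Bimod.regular F) (P := φ.toBimod) ?_
    change Bimod.π _ _ ≫ (Bimod.wL φ.toBimod φ.unitHom).hom ≫ φ.multHom.hom =
      Bimod.π _ _ ≫ (Bimod.rUnit φ.toBimod).hom.hom
    rw [Bimod.π_wL_assoc, π_multHom, Bimod.π_rUnit_hom]
    rfl
  assoc := by
    -- Precomposing with both quotients turns the bimodule associator into the associator of the
    -- underlying 1-cells, and the law into `M.assoc`.
    refine Bimod.cancelAssoc (L := φ.toBimod) (M := φ.toBimod) (N := φ.toBimod)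
      (P := φ.toBimod) ?_
    change Bimod.π φ.toBimod φ.toBimod ▷ t ≫ Bimod.π (Bimod.tensor φ.toBimod φ.toBimod) φ.toBimod ≫
          (Bimod.wR φ.multHom φ.toBimod).hom ≫ φ.multHom.hom =
      Bimod.π φ.toBimod φ.toBimod ▷ t ≫ Bimod.π (Bimod.tensor φ.toBimod φ.toBimod) φ.toBimod ≫
        (Bimod.assoc φ.toBimod φ.toBimod φ.toBimod).hom.hom ≫
          (Bimod.wL φ.toBimod φ.multHom).hom ≫ φ.multHom.hom
    rw [Bimod.π_wR_assoc, π_multHom, ← comp_whiskerRight_assoc, π_multHom,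
      M.assoc]
    refine Eq.trans ?_ (Bimod.ππ_assoc_hom_assoc φ.toBimod φ.toBimod φ.toBimod _).symm
    rw [Bimod.π_wL_assoc, π_multHom, ← whiskerLeft_comp_assoc, π_multHom]

end MonadHom
end RestrictionOfScalars
end PropMonads

namespace PropMonads

open CategoryTheory Bicategory Limits MonoidalCategory

/-! ### Calculus of arrows in a PROP: total composition, strictness and symmetries. -/

namespace PROP

variable {T : PROP.{u}}

open scoped Classical in
/-- Composition of arrows, extended to all pairs by an arbitrary value. -/
noncomputable def Ar.seq (f g : T.Ar) : T.Ar := if h : f.cod = g.dom then f.comp g h else f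

/-- The natural number that an object is. -/
def num (X : T.Ob) : ℕ := NatOb.n X

@[simp] theorem num_tensorObj (X Y : T.Ob) : num (X ⊗ Y) = num X + num Y :=
  congrArg NatOb.n (T.tensorObj_eq X Y)

/-- The source as a natural number. -/
def Ar.src (f : T.Ar) : ℕ := num f.dom

/-- The target as a natural number. -/
def Ar.tgt (f : T.Ar) : ℕ := num f.cod

/-- Moves composability from equality of objects to equality of natural numbers, where `simp` and
`lia` can decide it. -/
theorem Ar.cod_eq_dom_iff {f g : T.Ar} : f.cod = g.dom ↔ f.tgt = g.src :=
  ⟨congrArg NatOb.n, NatOb.ext⟩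

theorem Ar.seq_eq {f g : T.Ar} (h : f.cod = g.dom) : f.seq g = f.comp g h := dif_pos h

-- No composability is assumed: the default value of `Ar.seq` is its first argument, which has the
-- right source. The target does need the hypothesis.
@[simp] theorem Ar.src_seq (f g : T.Ar) : (f.seq g).src = f.src := by
  unfold Ar.seq
  split_ifs <;> rfl

theorem Ar.tgt_seq {f g : T.Ar} (h : f.tgt = g.src) : (f.seq g).tgt = g.tgt := by
  rw [Ar.seq_eq (Ar.cod_eq_dom_iff.2 h)]
  rfl

@[simp] theorem Ar.src_mul (f g : T.Ar) : (f * g).src = f.src + g.src :=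
  congrArg NatOb.n (T.domHom.map_mul f g)

@[simp] theorem Ar.tgt_mul (f g : T.Ar) : (f * g).tgt = f.tgt + g.tgt :=
  congrArg NatOb.n (T.codHom.map_mul f g)

theorem Ar.seq_assoc {f g k : T.Ar} (h₁ : f.tgt = g.src) (h₂ : g.tgt = k.src) :
    (f.seq g).seq k = f.seq (g.seq k) := by
  have h₁' := Ar.cod_eq_dom_iff.2 h₁
  have h₂' := Ar.cod_eq_dom_iff.2 h₂
  rw [Ar.seq_eq h₁', Ar.seq_eq h₂', Ar.seq_eq (f := f.comp g h₁') h₂',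
    Ar.seq_eq (g := g.comp k h₂') h₁']
  exact Ar.comp_assoc f g k h₁' h₂'

/-- The interchange law. -/
theorem Ar.mul_seq_mul {f f' g g' : T.Ar} (h : f.tgt = g.src) (h' : f'.tgt = g'.src) :
    (f * f').seq (g * g') = f.seq g * f'.seq g' := by
  have h₁ := Ar.cod_eq_dom_iff.2 h
  have h₁' := Ar.cod_eq_dom_iff.2 h'
  have hm : (f * f').cod = (g * g').dom := Ar.cod_eq_dom_iff.2 (by simp [h, h'])
  rw [Ar.seq_eq h₁, Ar.seq_eq h₁', Ar.seq_eq hm, Ar.mul_comp_mul]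

/-- Links the total operation used in the calculations to the composition relation used in the main
theorem. -/
theorem Ar.isComp_seq {f g : T.Ar} (h : f.tgt = g.src) : IsComp f g (f.seq g) := by
  have h' := Ar.cod_eq_dom_iff.2 h
  rw [Ar.seq_eq h']
  obtain ⟨f⟩ := f
  obtain ⟨g⟩ := g
  dsimp only at h'
  subst h'
  simpa [Ar.comp] using IsComp.mk f g

variable (T)

/-- The identity of a natural number. -/
def ident (n : ℕ) : T.Ar := T.idHom ⟨n⟩

@[simp] theorem src_ident (n : ℕ) : (T.ident n).src = n := rfl
@[simp] theorem tgt_ident (n : ℕ) : (T.ident n).tgt = n := rfl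

theorem ident_add (a b : ℕ) : T.ident (a + b) = T.ident a * T.ident b :=
  T.idHom.map_mul ⟨a⟩ ⟨b⟩

theorem ident_zero : T.ident 0 = 1 := T.idHom.map_one

variable {T}

theorem Ar.ident_seq {f : T.Ar} {n : ℕ} (h : n = f.src) : (T.ident n).seq f = f := by
  have h' : (T.ident n).cod = f.dom := Ar.cod_eq_dom_iff.2 h
  rw [Ar.seq_eq h']
  exact Ar.id_comp f _ h'

theorem Ar.seq_ident {f : T.Ar} {n : ℕ} (h : f.tgt = n) : f.seq (T.ident n) = f := by
  have h' : f.cod = (T.ident n).dom := Ar.cod_eq_dom_iff.2 h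
  rw [Ar.seq_eq h']
  exact Ar.comp_id f _ h'

/-- Transports equations between morphisms to equations in the monoid `T.Ar`, where strict
associativity of `⊕` holds without casts. -/
theorem Ar.mk_comp {X Y Z : T.Ob} (f : X ⟶ Y) (g : Y ⟶ Z) :
    (⟨f ≫ g⟩ : T.Ar) = Ar.seq ⟨f⟩ ⟨g⟩ := by
  rw [Ar.seq_eq (f := ⟨f⟩) (g := ⟨g⟩) rfl]
  simp [Ar.comp]

variable (T)

/-- The symmetry exchanging two blocks. -/
def swap (a b : ℕ) : T.Ar :=
  ⟨(BraidedCategory.braiding (C := T.Ob) (⟨a⟩ : NatOb.{u}) (⟨b⟩ : NatOb.{u})).hom⟩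

theorem swap_eq (X Y : T.Ob) :
    (⟨(BraidedCategory.braiding (C := T.Ob) X Y).hom⟩ : T.Ar) =
      T.swap (num X) (num Y) := rfl

@[simp] theorem src_swap (a b : ℕ) : (T.swap a b).src = a + b :=
  congrArg NatOb.n (T.tensorObj_eq ⟨a⟩ ⟨b⟩)

@[simp] theorem tgt_swap (a b : ℕ) : (T.swap a b).tgt = b + a :=
  congrArg NatOb.n (T.tensorObj_eq ⟨b⟩ ⟨a⟩)

theorem ident_tensorObj (X Y : T.Ob) :
    (⟨𝟙 (X ⊗ Y)⟩ : T.Ar) = T.ident (num X + NatOb.n Y) :=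
  (congrArg Ar.mk (id_tensorHom_id (C := T.Ob) X Y).symm).trans (T.ident_add _ _).symm

/-- In a PROP all coherence isomorphisms are of this form, so as elements of `T.Ar` they are
identities. This is what erases the associators from the hexagons below. -/
theorem mk_eqToHom {X Y : T.Ob} (h : X = Y) : (⟨eqToHom h⟩ : T.Ar) = T.ident (num X) := by
  subst h
  rfl

theorem mk_associator_hom (X Y Z : T.Ob) :
    (⟨(α_ X Y Z).hom⟩ : T.Ar) = T.ident (num ((X ⊗ Y) ⊗ Z)) :=
  (congrArg (fun k => Ar.mk k) (T.associator_eq X Y Z)).trans (T.mk_eqToHom _)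

theorem mk_associator_inv (X Y Z : T.Ob) :
    (⟨(α_ X Y Z).inv⟩ : T.Ar) = T.ident (num (X ⊗ (Y ⊗ Z))) := by
  have h : (X ⊗ Y) ⊗ Z = X ⊗ (Y ⊗ Z) := by
    exact NatOb.ext (by change num _ = num _; simp [add_assoc])
  have e : (α_ X Y Z).inv = eqToHom h.symm :=
    (Iso.inv_eq_inv (α_ X Y Z) (eqToIso h)).2 (T.associator_eq X Y Z)
  exact (congrArg (fun k => Ar.mk k) e).trans (T.mk_eqToHom _)

theorem mk_whiskerRight {X Y : T.Ob} (f : X ⟶ Y) (Z : T.Ob) :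
    (⟨f ▷ Z⟩ : T.Ar) = ⟨f⟩ * T.ident (num Z) :=
  congrArg Ar.mk (tensorHom_id f Z).symm

theorem mk_whiskerLeft {X Y : T.Ob} (Z : T.Ob) (f : X ⟶ Y) :
    (⟨Z ◁ f⟩ : T.Ar) = T.ident (num Z) * ⟨f⟩ :=
  congrArg Ar.mk (id_tensorHom Z f).symm

theorem swap_seq_swap (a b : ℕ) : (T.swap a b).seq (T.swap b a) = T.ident (a + b) :=
  ((Ar.mk_comp _ _).symm.trans (congrArg Ar.mk (SymmetricCategory.symmetry (C := T.Ob) _ _))).trans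
    (T.ident_tensorObj (⟨a⟩ : NatOb.{u}) (⟨b⟩ : NatOb.{u}))

theorem Ar.mul_seq_swap (f g : T.Ar) :
    (f * g).seq (T.swap f.tgt g.tgt) = (T.swap f.src g.src).seq (g * f) :=
  (Ar.mk_comp _ _).symm.trans ((congrArg Ar.mk
    (BraidedCategory.braiding_naturality (C := T.Ob) f.hom g.hom)).trans (Ar.mk_comp _ _))

/-- The hexagon axiom with its three associators read as identities and cancelled. -/
theorem swap_add_right (a b c : ℕ) :
    T.swap a (b + c) = (T.swap a b * T.ident c).seq (T.ident b * T.swap a c) := by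
  let X : T.Ob := (⟨a⟩ : NatOb.{u})
  let Y : T.Ob := (⟨b⟩ : NatOb.{u})
  let Z : T.Ob := (⟨c⟩ : NatOb.{u})
  have h := congrArg Ar.mk (BraidedCategory.hexagon_forward X Y Z)
  simp only [Ar.mk_comp, mk_whiskerRight, mk_whiskerLeft, mk_associator_hom, swap_eq] at h
  rw [Ar.ident_seq (by simp [add_assoc]), Ar.seq_ident (by simp [add_assoc]),
    Ar.ident_seq (by simp [add_assoc]), num_tensorObj] at h
  exact h

theorem swap_add_left (a b c : ℕ) :
    T.swap (a + b) c = (T.ident a * T.swap b c).seq (T.swap a c * T.ident b) := by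
  let X : T.Ob := (⟨a⟩ : NatOb.{u})
  let Y : T.Ob := (⟨b⟩ : NatOb.{u})
  let Z : T.Ob := (⟨c⟩ : NatOb.{u})
  have h := congrArg Ar.mk (BraidedCategory.hexagon_reverse X Y Z)
  simp only [Ar.mk_comp, mk_whiskerRight, mk_whiskerLeft, mk_associator_inv, swap_eq] at h
  rw [Ar.ident_seq (by simp [add_assoc]), Ar.seq_ident (by simp),
    Ar.ident_seq (by simp [add_assoc]), num_tensorObj] at h
  exact h

/-- The hexagon at `b = c = 0` makes this symmetry idempotent; it is also invertible, hence an
identity. -/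
theorem swap_zero_right (a : ℕ) : T.swap a 0 = T.ident a := by
  have h : (T.swap a 0).seq (T.swap a 0) = T.swap a 0 := by
    conv_rhs => rw [← Nat.add_zero 0, T.swap_add_right a 0 0]
    rw [T.ident_zero, mul_one, one_mul]
  calc T.swap a 0 = ((T.swap a 0).seq (T.swap a 0)).seq (T.swap 0 a) := by
        rw [Ar.seq_assoc (by simp) (by simp), T.swap_seq_swap, Ar.seq_ident (by simp)]
    _ = T.ident a := by rw [h, T.swap_seq_swap]; rfl

theorem swap_zero_left (a : ℕ) : T.swap 0 a = T.ident a := by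
  have h := T.swap_seq_swap 0 a
  rwa [T.swap_zero_right, Ar.seq_ident (by simp), zero_add] at h

end PROP

/-! ### Permutations: adjacent transpositions and removal of the first element. -/

namespace PermSum

/-- The transposition of `a` and `a + 1` among `a + 2 + b` elements. -/
def adjSwap {n : ℕ} (a b : ℕ) (h : a + 2 + b = n) : Equiv.Perm (Fin n) :=
  Equiv.swap ⟨a, by lia⟩ ⟨a + 1, by lia⟩

theorem adjSwap_val {n : ℕ} (a b : ℕ) (h : a + 2 + b = n) (i : Fin n) :
    (adjSwap a b h i : ℕ) = if (i : ℕ) = a then a + 1 else if (i : ℕ) = a + 1 then a else i := by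
  rw [adjSwap, Equiv.swap_apply_def]
  simp only [Fin.ext_iff]
  split_ifs <;> rfl

/-- Induction over permutations as composites of adjacent transpositions. -/
theorem perm_induction {n : ℕ} {p : Equiv.Perm (Fin n) → Prop} (refl : p (Equiv.refl _))
    (trans : ∀ σ τ, p σ → p τ → p (Equiv.trans σ τ))
    (adj : ∀ a b h, p (adjSwap a b h)) (σ : Equiv.Perm (Fin n)) : p σ := by
  cases n with
  | zero => rwa [Subsingleton.elim σ (Equiv.refl _)]
  | succ n =>
    -- Adjacent transpositions generate already as a monoid, so the induction has no case for
    -- inverses.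
    have hσ : σ ∈ Submonoid.closure
        (Set.range fun i : Fin n => Equiv.swap i.castSucc i.succ) := by
      rw [Equiv.Perm.mclosure_swap_castSucc_succ]
      trivial
    induction hσ using Submonoid.closure_induction with
    | mem σ hσ =>
      obtain ⟨i, rfl⟩ := hσ
      exact adj i (n - 1 - i) (by lia)
    | one => exact refl
    -- The product of permutations applies the right factor first, whereas `trans` is diagrammatic;
    -- hence the exchange.
    | mul σ τ _ _ h₁ h₂ => exact trans τ σ h₂ h₁

/-- The permutation of the last `n` elements, after the image of the first is left out. -/
def tail {n : ℕ} (σ : Equiv.Perm (Fin (n + 1))) : Equiv.Perm (Fin n) :=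
  (Equiv.Perm.decomposeFin (σ.trans (σ 0).cycleRange)).2

/-- The cycle `(σ 0).cycleRange` sends `σ 0` to `0` and keeps the order of the other elements. Hence
`ρ` fixes `0`, the transposition in its decomposition is trivial, and undoing the cycle on a
successor is the order embedding that skips `σ 0`. -/
theorem succAbove_tail {n : ℕ} (σ : Equiv.Perm (Fin (n + 1))) (j : Fin n) :
    (σ 0).succAbove (tail σ j) = σ j.succ := by
  set ρ : Equiv.Perm (Fin (n + 1)) := σ.trans (σ 0).cycleRange with hρ
  have h : Equiv.Perm.decomposeFin.symm (Equiv.Perm.decomposeFin ρ) = ρ := by simp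
  rw [← Prod.mk.eta (p := Equiv.Perm.decomposeFin ρ)] at h
  have h₀ : (Equiv.Perm.decomposeFin ρ).1 = 0 := by
    rw [← Equiv.Perm.decomposeFin_symm_apply_zero (Equiv.Perm.decomposeFin ρ).1
      (Equiv.Perm.decomposeFin ρ).2, h]
    simp [hρ]
  have h₁ := congrArg (fun τ : Equiv.Perm (Fin (n + 1)) => τ j.succ) h
  simp only [Equiv.Perm.decomposeFin_symm_apply_succ, h₀, Equiv.swap_self, Equiv.refl_apply] at h₁
  rw [← Fin.cycleRange_symm_succ]
  change (σ 0).cycleRange.symm ((Equiv.Perm.decomposeFin ρ).2 j).succ = _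
  rw [h₁]
  simp [hρ]

/-- The same fact on underlying numbers, so that later case distinctions are linear arithmetic. -/
theorem apply_succ_val {n : ℕ} (σ : Equiv.Perm (Fin (n + 1))) (j : Fin n) :
    (σ j.succ : ℕ) = if (tail σ j : ℕ) < σ 0 then (tail σ j : ℕ) else tail σ j + 1 := by
  rw [← succAbove_tail, Fin.succAbove]
  simp only [Fin.lt_def, Fin.val_castSucc]
  split_ifs <;> rfl

/-- Skipping the value `k` is injective, so the values of `σ` on successors determine the tail. -/
theorem tail_eq {n k : ℕ} {σ : Equiv.Perm (Fin (n + 1))} {τ : Equiv.Perm (Fin n)}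
    (h₀ : (σ 0 : ℕ) = k)
    (h : ∀ j, (σ j.succ : ℕ) = if (τ j : ℕ) < k then (τ j : ℕ) else τ j + 1) : tail σ = τ := by
  subst h₀
  refine Equiv.ext fun j => Fin.ext ?_
  have h₁ := (apply_succ_val σ j).symm.trans (h j)
  split_ifs at h₁ <;> lia

end PermSum

/-! ### The arrow of a permutation, and its compatibility with composition and `⊕`. -/

namespace PROP

open PermSum

variable (T : PROP.{u})

/-- The symmetry exchanging two adjacent elements. -/
def adj (a b : ℕ) : T.Ar := T.ident a * T.swap 1 1 * T.ident b

@[simp] theorem src_adj (a b : ℕ) : (T.adj a b).src = a + 2 + b := by simp [adj]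
@[simp] theorem tgt_adj (a b : ℕ) : (T.adj a b).tgt = a + 2 + b := by simp [adj]

theorem ident_mul_adj (a b c : ℕ) : T.ident a * T.adj b c = T.adj (a + b) c := by
  simp only [adj, ident_add, mul_assoc]

theorem adj_mul_ident (a b c : ℕ) : T.adj a b * T.ident c = T.adj a (b + c) := by
  simp only [adj, ident_add, mul_assoc]

theorem adj_seq_adj (a b : ℕ) : (T.adj a b).seq (T.adj a b) = T.ident (a + 2 + b) := by
  rw [adj, Ar.mul_seq_mul (by simp) (by simp), Ar.mul_seq_mul (by simp) (by simp), swap_seq_swap,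
    Ar.ident_seq (by simp), Ar.ident_seq (by simp), T.ident_add (a + 2) b,
    T.ident_add a 2]

/-- The symmetry moving the first element behind the next `k`. -/
def shift (k l : ℕ) : T.Ar := T.swap 1 k * T.ident l

@[simp] theorem src_shift (k l : ℕ) : (T.shift k l).src = 1 + k + l := by simp [shift]
@[simp] theorem tgt_shift (k l : ℕ) : (T.shift k l).tgt = k + 1 + l := by simp [shift]

/-- The hexagon for `1` and `k + 1`: passing `k + 1` elements is passing `k` of them and then one
more. -/
theorem shift_seq_adj_self (k l : ℕ) :
    (T.shift k (1 + l)).seq (T.adj k l) = T.shift (k + 1) l := by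
  rw [shift, shift, adj, swap_add_right, ident_add, ← mul_assoc,
    Ar.mul_seq_mul (by simp) (by simp), Ar.ident_seq (by simp)]

theorem shift_succ_seq_adj (k l : ℕ) :
    (T.shift (k + 1) l).seq (T.adj k l) = T.shift k (1 + l) := by
  rw [← shift_seq_adj_self, Ar.seq_assoc (by simp; lia) (by simp), adj_seq_adj,
    Ar.seq_ident (by simp; lia)]

/-- The transposed elements lie outside the `1 + k` elements that the shift moves, so the two
commute by interchange. -/
theorem shift_seq_adj_right (k b c : ℕ) :
    (T.shift k (c + 2 + b)).seq (T.adj (k + 1 + c) b) =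
      (T.ident 1 * T.adj (k + c) b).seq (T.shift k (c + 2 + b)) := by
  rw [ident_mul_adj, ← add_assoc, ← ident_mul_adj, ← ident_mul_adj, shift,
    Ar.mul_seq_mul (by simp) (by simp), Ar.mul_seq_mul (by simp) (by simp),
    Ar.seq_ident (by simp), Ar.ident_seq (by simp), Ar.ident_seq (by simp), Ar.seq_ident (by simp)]

/-- Both transposed elements lie in the block that the first element passes, so naturality of the
symmetry carries the transposition across; before the shift the block starts one place later. -/
theorem shift_seq_adj_left (a c l : ℕ) :
    (T.shift (a + 2 + c) l).seq (T.adj a (c + 1 + l)) =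
      (T.ident 1 * T.adj a (c + l)).seq (T.shift (a + 2 + c) l) := by
  have h := Ar.mul_seq_swap T (T.ident 1) (T.adj a c)
  simp only [src_ident, tgt_ident, src_adj, tgt_adj] at h
  rw [← adj_mul_ident, ← adj_mul_ident, ← adj_mul_ident, ← mul_assoc, shift,
    Ar.mul_seq_mul (by simp) (by simp), Ar.mul_seq_mul (by simp) (by simp), h]

/-- The arrow given by a permutation. -/
noncomputable def ofPerm : ∀ n : ℕ, Equiv.Perm (Fin n) → T.Ar
  | 0, _ => 1
  -- First arrange the last `n` elements among themselves, then move the first one past `σ 0` of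
  -- them; `n - σ 0` elements stay behind it.
  | n + 1, σ => (T.ident 1 * ofPerm n (tail σ)).seq (T.shift (σ 0) (n - σ 0))

-- The recursion step for any data `k`, `l`, `τ` with the right values, which avoids computing
-- `tail` of a composite directly and avoids truncated subtraction.
variable {T} in
theorem ofPerm_succ {n k l : ℕ} {σ : Equiv.Perm (Fin (n + 1))} {τ : Equiv.Perm (Fin n)}
    (hn : k + l = n) (h₀ : (σ 0 : ℕ) = k)
    (h : ∀ j, (σ j.succ : ℕ) = if (τ j : ℕ) < k then (τ j : ℕ) else τ j + 1) :
    T.ofPerm (n + 1) σ = (T.ident 1 * T.ofPerm n τ).seq (T.shift k l) := by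
  rw [ofPerm, tail_eq h₀ h, h₀, show n - k = l by lia]

theorem src_tgt_ofPerm (n : ℕ) (σ : Equiv.Perm (Fin n)) :
    (T.ofPerm n σ).src = n ∧ (T.ofPerm n σ).tgt = n := by
  induction n with
  | zero => exact ⟨congrArg NatOb.n T.tensorUnit_eq, congrArg NatOb.n T.tensorUnit_eq⟩
  | succ n ih =>
    have h := (σ 0).is_lt
    rw [ofPerm, Ar.src_seq, Ar.tgt_seq (by simp [(ih _).2]; lia)]
    simp [(ih _).1]
    lia

@[simp] theorem src_ofPerm (n : ℕ) (σ : Equiv.Perm (Fin n)) : (T.ofPerm n σ).src = n :=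
  (T.src_tgt_ofPerm n σ).1

@[simp] theorem tgt_ofPerm (n : ℕ) (σ : Equiv.Perm (Fin n)) : (T.ofPerm n σ).tgt = n :=
  (T.src_tgt_ofPerm n σ).2

theorem ofPerm_refl (n : ℕ) : T.ofPerm n (Equiv.refl _) = T.ident n := by
  induction n with
  | zero => exact T.ident_zero.symm
  | succ n ih =>
    rw [ofPerm_succ (τ := Equiv.refl _) (Nat.zero_add n) rfl (by simp), ih, shift, swap_zero_right,
      Ar.mul_seq_mul (by simp) (by simp), Ar.ident_seq (by simp), Ar.ident_seq (by simp),
      ← ident_add, add_comm]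

/-- The core of functoriality. Write `k = σ 0`. If `k` is neither `a` nor `a + 1`, the transposition
passes through the shift and acts on the tail, where induction applies. If `k` is one of the two,
only the image of the first element changes and the tail stays the same. -/
theorem ofPerm_trans_adjSwap (n : ℕ) (σ : Equiv.Perm (Fin n)) (a b : ℕ) (h : a + 2 + b = n) :
    T.ofPerm n (σ.trans (adjSwap a b h)) = (T.ofPerm n σ).seq (T.adj a b) := by
  induction n generalizing a b with
  | zero => lia
  | succ n ih =>
    obtain ⟨k, hk⟩ : ∃ k : ℕ, (σ 0 : ℕ) = k := ⟨_, rfl⟩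
    obtain ⟨l, hl⟩ : ∃ l, k + l = n := ⟨n - k, by have := (σ 0).is_lt; lia⟩
    have hσ := apply_succ_val σ
    rw [hk] at hσ
    rw [ofPerm_succ hl hk hσ]
    have hτ := T.tgt_ofPerm n (tail σ)
    rcases lt_trichotomy k a with h₁ | h₁ | h₁
    -- Beyond `k`, positions in the tail are one lower, so the tail is changed by the transposition
    -- at `k + c = a - 1`.
    · obtain ⟨c, rfl⟩ : ∃ c, a = k + 1 + c := ⟨a - (k + 1), by lia⟩
      obtain rfl : l = c + 2 + b := by lia
      rw [ofPerm_succ (τ := (tail σ).trans (adjSwap (k + c) b (by lia))) hl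
          (by rw [Equiv.trans_apply, adjSwap_val]; split_ifs <;> lia)
          (fun j => by simp only [Equiv.trans_apply, adjSwap_val, hσ]; split_ifs <;> lia), ih,
        Ar.seq_assoc (by simp; lia) (by simp; lia), shift_seq_adj_right,
        ← Ar.seq_assoc (by simp; lia) (by simp; lia), Ar.mul_seq_mul (by simp) (by simp; lia),
        Ar.ident_seq (by simp)]
    -- The first element moves one place further, from `k` to `k + 1`.
    · subst h₁
      obtain rfl : l = 1 + b := by lia
      rw [ofPerm_succ (k := k + 1) (l := b) (τ := tail σ) (by lia)
          (by rw [Equiv.trans_apply, adjSwap_val]; split_ifs <;> lia)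
          (fun j => by simp only [Equiv.trans_apply, adjSwap_val, hσ]; split_ifs <;> lia),
        Ar.seq_assoc (by simp; lia) (by simp; lia), shift_seq_adj_self]
    · obtain rfl | ⟨c, rfl⟩ : k = a + 1 ∨ ∃ c, k = a + 2 + c := by
        by_cases e : k = a + 1
        · exact Or.inl e
        · exact Or.inr ⟨k - (a + 2), by lia⟩
      -- The first element moves one place back, from `a + 1` to `a`, since the transposition is an
      -- involution.
      · obtain rfl : b = l := by lia
        rw [ofPerm_succ (k := a) (l := 1 + b) (τ := tail σ) (by lia)
            (by rw [Equiv.trans_apply, adjSwap_val]; split_ifs <;> lia)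
            (fun j => by simp only [Equiv.trans_apply, adjSwap_val, hσ]; split_ifs <;> lia),
          Ar.seq_assoc (by simp; lia) (by simp), shift_succ_seq_adj]
      -- Below `k`, positions in the tail agree with those in `σ`, so the index `a` is unchanged.
      · obtain rfl : b = c + 1 + l := by lia
        rw [ofPerm_succ (τ := (tail σ).trans (adjSwap a (c + l) (by lia))) hl
            (by rw [Equiv.trans_apply, adjSwap_val]; split_ifs <;> lia)
            (fun j => by simp only [Equiv.trans_apply, adjSwap_val, hσ]; split_ifs <;> lia), ih,
          Ar.seq_assoc (by simp; lia) (by simp; lia), shift_seq_adj_left,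
          ← Ar.seq_assoc (by simp; lia) (by simp; lia), Ar.mul_seq_mul (by simp) (by simp; lia),
          Ar.ident_seq (by simp)]

theorem ofPerm_adjSwap (n a b : ℕ) (h : a + 2 + b = n) :
    T.ofPerm n (adjSwap a b h) = T.adj a b := by
  have e := T.ofPerm_trans_adjSwap n (Equiv.refl _) a b h
  rwa [ofPerm_refl, Ar.ident_seq (by simp [h]), Equiv.refl_trans] at e

/-- Induction on `τ` through the generators, with `σ` arbitrary so that the hypotheses apply to
longer composites. -/
theorem ofPerm_trans (n : ℕ) (σ τ : Equiv.Perm (Fin n)) :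
    T.ofPerm n (σ.trans τ) = (T.ofPerm n σ).seq (T.ofPerm n τ) := by
  induction τ using perm_induction generalizing σ with
  | refl => rw [ofPerm_refl, Equiv.trans_refl, Ar.seq_ident (by simp)]
  | trans τ τ' h₁ h₂ =>
    rw [← Equiv.trans_assoc, h₂, h₁, h₂ τ, Ar.seq_assoc (by simp) (by simp)]
  | adj a b h => rw [ofPerm_trans_adjSwap, ofPerm_adjSwap]

/-- Both sides respect composition in `σ`, so it is enough to compare them on adjacent
transpositions, where each is `adj a (b + n)`. -/
theorem ofPerm_sum_refl (m n : ℕ) (σ : Equiv.Perm (Fin m)) :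
    T.ofPerm (m + n) (sum σ (Equiv.refl (Fin n))) = T.ofPerm m σ * T.ident n := by
  induction σ using perm_induction with
  | refl => rw [sum_refl, ofPerm_refl, ofPerm_refl, ident_add]
  | trans σ τ h₁ h₂ =>
    rw [← Equiv.trans_refl (Equiv.refl (Fin n)), sum_trans, ofPerm_trans, h₁, h₂, ofPerm_trans,
      Ar.mul_seq_mul (by simp) (by simp), Ar.ident_seq (by simp)]
  | adj a b h =>
    rw [ofPerm_adjSwap, adj_mul_ident, ← T.ofPerm_adjSwap (m + n) a (b + n) (by lia)]
    congr 1
    refine ext_sum (fun i => Fin.ext ?_) (fun i => Fin.ext ?_)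
    · simp [adjSwap_val]
    · rw [sum_natAdd, adjSwap_val, if_neg, if_neg] <;> simp <;> lia

theorem ofPerm_refl_sum (m n : ℕ) (σ : Equiv.Perm (Fin n)) :
    T.ofPerm (m + n) (sum (Equiv.refl (Fin m)) σ) = T.ident m * T.ofPerm n σ := by
  induction σ using perm_induction with
  | refl => rw [sum_refl, ofPerm_refl, ofPerm_refl, ident_add]
  | trans σ τ h₁ h₂ =>
    rw [← Equiv.trans_refl (Equiv.refl (Fin m)), sum_trans, ofPerm_trans, h₁, h₂, ofPerm_trans,
      Ar.mul_seq_mul (by simp) (by simp), Ar.ident_seq (by simp)]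
  | adj a b h =>
    rw [ofPerm_adjSwap, ident_mul_adj, ← T.ofPerm_adjSwap (m + n) (m + a) b (by lia)]
    congr 1
    refine ext_sum (fun i => Fin.ext ?_) (fun i => Fin.ext ?_)
    · rw [sum_castAdd, adjSwap_val, if_neg, if_neg] <;> simp <;> lia
    · rw [sum_natAdd, adjSwap_val]
      simp only [Fin.val_natAdd, adjSwap_val]
      split_ifs <;> lia

/-- Factor `σ ⊕ τ` as `(σ ⊕ id) ; (id ⊕ τ)` and apply interchange. -/
theorem ofPerm_sum (m n : ℕ) (σ : Equiv.Perm (Fin m)) (τ : Equiv.Perm (Fin n)) :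
    T.ofPerm (m + n) (sum σ τ) = T.ofPerm m σ * T.ofPerm n τ := by
  have h := sum_trans σ (Equiv.refl _) (Equiv.refl _) τ
  rw [Equiv.trans_refl, Equiv.refl_trans] at h
  rw [h, ofPerm_trans, ofPerm_sum_refl, ofPerm_refl_sum, Ar.mul_seq_mul (by simp) (by simp),
    Ar.seq_ident (by simp), Ar.ident_seq (by simp)]

/-! ### Generators of the PROP of permutations, and its initiality on arrows. -/

/-- A permutation as an arrow of the PROP of permutations. -/
def permAr {n : ℕ} (σ : Equiv.Perm (Fin n)) : perm.{u}.Ar :=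
  Ar.mk (T := perm.{u}) (dom := (⟨n⟩ : NatOb.{u})) (cod := (⟨n⟩ : NatOb.{u}))
    (⟨σ⟩ : PermOb.Hom.{u} (⟨n⟩ : NatOb.{u}) (⟨n⟩ : NatOb.{u}))

@[simp] theorem src_permAr {n : ℕ} (σ : Equiv.Perm (Fin n)) : (permAr.{u} σ).src = n := rfl
@[simp] theorem tgt_permAr {n : ℕ} (σ : Equiv.Perm (Fin n)) : (permAr.{u} σ).tgt = n := rfl

theorem exists_permAr (f : perm.{u}.Ar) : ∃ (n : ℕ) (σ : Equiv.Perm (Fin n)), f = permAr σ := by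
  obtain ⟨f⟩ := f
  rename_i X Y
  obtain ⟨m⟩ := X
  obtain ⟨n⟩ := Y
  let f' : PermOb.Hom.{u} (⟨m⟩ : NatOb.{u}) (⟨n⟩ : NatOb.{u}) := f
  obtain rfl : m = n := Fin.equiv_iff_eq.1 ⟨f'.equiv⟩
  exact ⟨m, f'.equiv, rfl⟩

theorem permAr_seq {n : ℕ} (σ τ : Equiv.Perm (Fin n)) :
    (permAr.{u} σ).seq (permAr τ) = permAr (σ.trans τ) :=
  (Ar.mk_comp _ _).symm

theorem permAr_mul {m n : ℕ} (σ : Equiv.Perm (Fin m)) (τ : Equiv.Perm (Fin n)) :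
    permAr.{u} σ * permAr τ = permAr (sum σ τ) := rfl

theorem permAr_refl (n : ℕ) : permAr.{u} (Equiv.refl (Fin n)) = perm.ident n := rfl

theorem permAr_flip : permAr.{u} (adjSwap (n := 2) 0 0 rfl) = perm.swap 1 1 := by
  change permAr.{u} (adjSwap (n := 2) 0 0 rfl) = permAr (finAddFlip (m := 1) (n := 1))
  congr 1
  decide

variable {T : PROP.{u}}

/-- Exhibits the generators of the symmetric groups inside `P` in terms of identities, `⊕` and the
symmetry of `1` and `1`; uniqueness rests on this. It is checked on the three blocks of sizes `a`,
`2` and `b`. -/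
theorem permAr_adjSwap {n : ℕ} (a b : ℕ) (h : a + 2 + b = n) :
    permAr.{u} (adjSwap a b h) = perm.adj a b := by
  subst h
  rw [adj, ← permAr_flip, ← permAr_refl, ← permAr_refl, permAr_mul, permAr_mul]
  congr 1
  refine ext_sum₃ (fun i => Fin.ext ?_) (fun i => Fin.ext ?_) (fun i => Fin.ext ?_)
  · rw [adjSwap_val, if_neg, if_neg] <;> simp <;> lia
  · simp only [sum_castAdd, sum_natAdd, Fin.val_castAdd, Fin.val_natAdd, adjSwap_val]
    split_ifs <;> lia
  · rw [adjSwap_val, if_neg, if_neg] <;> simp <;> lia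

/-- The arrow given by an arrow of the PROP of permutations. -/
noncomputable def ofAr (T : PROP.{u}) (f : perm.{u}.Ar) : T.Ar :=
  T.ofPerm (exists_permAr f).choose (exists_permAr f).choose_spec.choose

/-- Makes the choice of representative in `ofAr` harmless. -/
theorem permAr_inj {m n : ℕ} {σ : Equiv.Perm (Fin m)} {τ : Equiv.Perm (Fin n)}
    (h : permAr.{u} σ = permAr τ) : T.ofPerm m σ = T.ofPerm n τ := by
  obtain rfl : m = n := congrArg Ar.src h
  injection h with _ _ h
  exact congrArg (fun k : PermOb.Hom.{u} _ _ => T.ofPerm m k.equiv) h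

theorem ofAr_permAr {n : ℕ} (σ : Equiv.Perm (Fin n)) : T.ofAr (permAr σ) = T.ofPerm n σ :=
  (permAr_inj (exists_permAr (permAr.{u} σ)).choose_spec.choose_spec).symm

/-- A map of arrows that preserves composition, the monoidal product, identities and the symmetry
of `1` and `1` preserves all symmetries. -/
theorem map_swap {S T : PROP.{u}} (φ : S.Ar → T.Ar)
    (map_seq : ∀ f g : S.Ar, f.tgt = g.src → φ (f.seq g) = (φ f).seq (φ g))
    (map_mul : ∀ f g : S.Ar, φ (f * g) = φ f * φ g)
    (map_ident : ∀ n, φ (S.ident n) = T.ident n)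
    (map_one_one : φ (S.swap 1 1) = T.swap 1 1) (a b : ℕ) : φ (S.swap a b) = T.swap a b := by
  -- One hexagon extends the second block from `1` to `b`; the other then extends the first block
  -- from `1` to `a`.
  have h (b : ℕ) : φ (S.swap 1 b) = T.swap 1 b := by
    induction b with
    | zero => rw [swap_zero_right, swap_zero_right, map_ident]
    | succ b ih =>
      rw [swap_add_right, swap_add_right, map_seq _ _ (by simp), map_mul, map_mul, ih, map_ident,
        map_ident, map_one_one]
  induction a with
  | zero => rw [swap_zero_left, swap_zero_left, map_ident]
  | succ a ih =>
    rw [swap_add_left, swap_add_left, map_seq _ _ (by simp [add_assoc]), map_mul, map_mul, ih, map_ident,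
      map_ident, h]

/-- Such a map out of the PROP of permutations is unique. -/
theorem eq_ofAr (φ : perm.{u}.Ar → T.Ar)
    (map_seq : ∀ f g : perm.Ar, f.tgt = g.src → φ (f.seq g) = (φ f).seq (φ g))
    (map_mul : ∀ f g : perm.Ar, φ (f * g) = φ f * φ g)
    (map_ident : ∀ n, φ (perm.ident n) = T.ident n)
    (map_one_one : φ (perm.swap 1 1) = T.swap 1 1) (f : perm.Ar) : φ f = T.ofAr f := by
  obtain ⟨n, σ, rfl⟩ := exists_permAr f
  rw [ofAr_permAr]
  induction σ using perm_induction with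
  | refl => rw [permAr_refl, map_ident, ofPerm_refl]
  | trans σ τ h₁ h₂ => rw [← permAr_seq, map_seq _ _ (by simp), h₁, h₂, ofPerm_trans]
  | adj a b h =>
    rw [permAr_adjSwap, ofPerm_adjSwap, adj, adj, map_mul, map_mul, map_ident, map_ident,
      map_one_one]

theorem ofAr_seq (f g : perm.{u}.Ar) (h : f.tgt = g.src) :
    T.ofAr (f.seq g) = (T.ofAr f).seq (T.ofAr g) := by
  obtain ⟨m, σ, rfl⟩ := exists_permAr f
  obtain ⟨n, τ, rfl⟩ := exists_permAr g
  obtain rfl : m = n := h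
  rw [permAr_seq, ofAr_permAr, ofAr_permAr, ofAr_permAr, ofPerm_trans]

theorem ofAr_mul (f g : perm.{u}.Ar) : T.ofAr (f * g) = T.ofAr f * T.ofAr g := by
  obtain ⟨m, σ, rfl⟩ := exists_permAr f
  obtain ⟨n, τ, rfl⟩ := exists_permAr g
  rw [permAr_mul, ofAr_permAr, ofAr_permAr, ofAr_permAr, ofPerm_sum]

theorem ofAr_ident (n : ℕ) : T.ofAr (perm.ident n) = T.ident n := by
  rw [← permAr_refl, ofAr_permAr, ofPerm_refl]

theorem ofAr_swap (a b : ℕ) : T.ofAr (perm.swap a b) = T.swap a b := by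
  -- No normal form of a block exchange is computed: only the symmetry of `1` and `1` remains, and
  -- it is an adjacent transposition.
  refine map_swap T.ofAr ofAr_seq ofAr_mul ofAr_ident ?_ a b
  rw [← permAr_flip, ofAr_permAr, ofPerm_adjSwap, adj, ident_zero, mul_one, one_mul]

theorem src_ofAr (f : perm.{u}.Ar) : (T.ofAr f).src = f.src := by
  obtain ⟨n, σ, rfl⟩ := exists_permAr f
  simp [ofAr_permAr]

theorem tgt_ofAr (f : perm.{u}.Ar) : (T.ofAr f).tgt = f.tgt := by
  obtain ⟨n, σ, rfl⟩ := exists_permAr f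
  simp [ofAr_permAr]

/-! ### Morphisms of PROPs versus maps on sets of arrows. -/

/-- An arrow with prescribed source and target. -/
theorem Ar.exists_hom {f : T.Ar} {X Y : T.Ob} (hX : f.src = num X) (hY : f.tgt = num Y) :
    ∃ k : X ⟶ Y, (⟨k⟩ : T.Ar) = f := by
  obtain rfl : f.dom = X := NatOb.ext hX
  obtain rfl : f.cod = Y := NatOb.ext hY
  exact ⟨f.hom, rfl⟩

theorem Ar.mk_injective {X Y : T.Ob} {f g : X ⟶ Y} (h : (⟨f⟩ : T.Ar) = ⟨g⟩) : f = g := by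
  injection h with _ _ h

/-- A morphism of PROPs from its action on arrows. -/
noncomputable def Hom.ofMap {S T : PROP.{u}} (φ : S.Ar → T.Ar)
    (src_map : ∀ f, (φ f).src = f.src) (tgt_map : ∀ f, (φ f).tgt = f.tgt)
    (map_seq : ∀ f g : S.Ar, f.tgt = g.src → φ (f.seq g) = (φ f).seq (φ g))
    (map_mul : ∀ f g : S.Ar, φ (f * g) = φ f * φ g)
    (map_ident : ∀ n, φ (S.ident n) = T.ident n)
    (map_swap : ∀ a b, φ (S.swap a b) = T.swap a b) : Hom S T :=
  -- The ends of `φ ⟨f⟩` agree with `X` and `Y` only propositionally, so a morphism `X ⟶ Y`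
  -- representing it is chosen. Each law is then checked in `T.Ar`, where that choice is invisible.
  have h {X Y : NatOb.{u}} (f : Quiver.Hom (V := S.Ob) X Y) :=
    Ar.exists_hom (T := T) (X := X) (Y := Y) (src_map ⟨f⟩) (tgt_map ⟨f⟩)
  { map := fun f => (h f).choose
    map_id := fun X => Ar.mk_injective ((h (𝟙 X)).choose_spec.trans (map_ident (num X)))
    map_comp := fun f g => Ar.mk_injective (by
      refine (h (f ≫ g)).choose_spec.trans (Eq.trans ?_ (Ar.mk_comp _ _).symm)
      rw [Ar.mk_comp, map_seq _ _ rfl]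
      exact (congrArg₂ Ar.seq (h f).choose_spec (h g).choose_spec).symm)
    map_tensor := fun f g => by
      refine (h (f ⊗ₘ g)).choose_spec.trans ?_
      exact (map_mul ⟨f⟩ ⟨g⟩).trans
        (congrArg₂ (· * ·) (h f).choose_spec (h g).choose_spec).symm
    map_braiding := fun X Y =>
      (h (BraidedCategory.braiding (C := S.Ob) X Y).hom).choose_spec.trans
        (map_swap (NatOb.n X) (NatOb.n Y)) }

theorem Hom.ofMap_ar {S T : PROP.{u}} {φ : S.Ar → T.Ar} {h₁ h₂ h₃ h₄ h₅ h₆} (f : S.Ar) :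
    (Hom.ofMap φ h₁ h₂ h₃ h₄ h₅ h₆).ar f = φ f :=
  (Ar.exists_hom (T := T) (X := f.dom) (Y := f.cod) (h₁ f) (h₂ f)).choose_spec

theorem tgt_fst {S T : PROP.{u}} (x : (Sp.comp S.span T.span).apex) :
    (fst x).tgt = (snd x).src :=
  congrArg NatOb.n (Sp.cond_apply S.span T.span x)

theorem mult_eq_seq (x : (Sp.comp T.span T.span).apex) : T.mult.hom x = (fst x).seq (snd x) :=
  (Ar.seq_eq (cod_eq_dom x)).symm

/-! ### Morphisms of PROPs as morphisms of monads in spans of monoids. -/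

namespace Hom

variable {S T : PROP.{u}} (F : Hom S T)

theorem ar_seq (f g : S.Ar) (h : f.tgt = g.src) : F.ar (f.seq g) = (F.ar f).seq (F.ar g) := by
  obtain ⟨f⟩ := f
  obtain ⟨g⟩ := g
  obtain rfl := Ar.cod_eq_dom_iff.2 h
  rw [← Ar.mk_comp]
  exact (congrArg Ar.mk (F.map_comp f g)).trans (Ar.mk_comp _ _)

theorem ar_mul (f g : S.Ar) : F.ar (f * g) = F.ar f * F.ar g := F.map_tensor f.hom g.hom

theorem ar_ident (n : ℕ) : F.ar (S.ident n) = T.ident n :=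
  congrArg Ar.mk (F.map_id (⟨n⟩ : NatOb.{u}))

theorem ar_swap (a b : ℕ) : F.ar (S.swap a b) = T.swap a b := F.map_braiding _ _

theorem ar_injective {F G : Hom S T} (h : ∀ f, F.ar f = G.ar f) : F = G := by
  refine Hom.ext ?_
  funext X Y f
  exact Ar.mk_injective (h ⟨f⟩)

/-- A morphism of PROPs as a homomorphism of monoids of arrows. -/
def arHom : S.Ar →* T.Ar where
  toFun := F.ar
  map_one' := by rw [← ident_zero, ar_ident, ident_zero]
  map_mul' := F.ar_mul

/-- A morphism of PROPs as a morphism of spans. -/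
def spanHom : S.span ⟶ T.span :=
  show Sp.mk (x := natMon) (y := natMon) _ _ ⟶ T.span from
  { hom := MonCat.ofHom F.arHom
    hom_l := rfl
    hom_r := rfl }

/-- A morphism of PROPs as a morphism of monads. -/
noncomputable def monadHom : MonadHom S.toMod T.monad where
  hom := F.spanHom
  η_hom := Span.hom_ext (ConcreteCategory.hom_ext _ _ fun n => F.ar_ident (NatOb.n n))
  μ_hom := by
    refine Span.hom_ext (ConcreteCategory.hom_ext _ _ fun x => ?_)
    let x' : (Sp.comp S.span S.span).apex := x
    change F.ar (S.mult.hom x') = T.mult.hom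
      ((Sp.wL T.span F.spanHom).hom ((Sp.wR F.spanHom S.span).hom x'))
    rw [mult_eq_seq, F.ar_seq _ _ (tgt_fst x')]
    refine Eq.trans ?_ (mult_eq_seq _).symm
    -- Both sides are composites in `T`, so it remains to compare the two projections of the
    -- pullback; the whiskerings apply `F` to one factor each.
    refine congrArg₂ Ar.seq ?_ ?_
    · exact ((Sp.wL_apply₁ T.span F.spanHom _).trans (Sp.wR_apply₁ F.spanHom S.span x')).symm
    · exact ((Sp.wL_apply₂ T.span F.spanHom _).trans
        (congrArg F.ar (Sp.wR_apply₂ F.spanHom S.span x'))).symm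

/-- Unfolds the abstract action: whiskering applies `F` to the first component, and the
multiplication of `T` then composes. -/
theorem onArrows_bimodStr_l (x : (Sp.comp S.span T.span).apex) :
    onArrows (S := S) F.monadHom.bimodStr.l x = (F.ar (fst x)).seq (snd x) := by
  refine (mult_eq_seq ((Sp.wR F.spanHom T.span).hom x)).trans ?_
  exact congrArg₂ Ar.seq (Sp.wR_apply₁ F.spanHom T.span x) (Sp.wR_apply₂ F.spanHom T.span x)

theorem onArrows_bimodStr_r (x : (Sp.comp T.span S.span).apex) :
    onArrows (T := S) F.monadHom.bimodStr.r x = (fst x).seq (F.ar (snd x)) := by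
  refine (mult_eq_seq ((Sp.wL T.span F.spanHom).hom x)).trans ?_
  exact congrArg₂ Ar.seq (Sp.wL_apply₁ T.span F.spanHom x) (Sp.wL_apply₂ T.span F.spanHom x)

end Hom

/-- The morphism from the PROP of permutations. -/
noncomputable def ofPermHom (T : PROP.{u}) : Hom perm T :=
  Hom.ofMap T.ofAr src_ofAr tgt_ofAr ofAr_seq ofAr_mul ofAr_ident ofAr_swap

/-- A morphism of PROPs is determined by its map on arrows, which `eq_ofAr` forces. -/
theorem eq_ofPermHom (F : Hom perm T) : F = T.ofPermHom :=
  Hom.ar_injective fun f =>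
    (eq_ofAr F.ar F.ar_seq F.ar_mul F.ar_ident (F.ar_swap 1 1) f).trans
      (Hom.ofMap_ar f).symm

end PROP
end PropMonads

/-! ### Assembly of the two halves. -/

theorem mainTheorem2 (T : PROP.{u}) :
    ∃ ι : PROP.Hom PROP.perm T, (∀ ι' : PROP.Hom PROP.perm T, ι' = ι) ∧
      ∃ (A : BimodStr PROP.perm.{u}.toMod PROP.perm.{u}.toMod T.span) (M : MonadOn (T.bimod A)),
        (∀ x : (Sp.comp PROP.perm.{u}.span T.span).apex,
          PROP.IsComp (ι.ar (PROP.fst x)) (PROP.snd x) (PROP.onArrows A.l x)) ∧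
        (∀ x : (Sp.comp T.span PROP.perm.{u}.span).apex,
          PROP.IsComp (PROP.fst x) (ι.ar (PROP.snd x)) (PROP.onArrows A.r x)) ∧
        (∀ x : (Sp.comp T.span T.span).apex,
          PROP.IsComp (PROP.fst x) (PROP.snd x) (PROP.onPairs M.μ x)) ∧
        ∀ p : PROP.perm.{u}.Ar, PROP.onPerm M.η p = ι.ar p := by
  refine ⟨T.ofPermHom, PROP.eq_ofPermHom, T.ofPermHom.monadHom.bimodStr,
    T.ofPermHom.monadHom.bimodMonad, fun x => ?_, fun x => ?_, fun x => ?_, fun p => rfl⟩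
  · rw [PROP.Hom.onArrows_bimodStr_l]
    exact PROP.Ar.isComp_seq (PROP.tgt_fst x)
  · rw [PROP.Hom.onArrows_bimodStr_r]
    exact PROP.Ar.isComp_seq (PROP.tgt_fst x)
  -- `onPairs` restricts along the quotient 2-cell, and along it the descended multiplication is the
  -- composition of `T` again.
  · have h : PROP.onPairs T.ofPermHom.monadHom.bimodMonad.μ x = T.mult.hom x :=
      congrArg (fun k : T.span ≫ T.span ⟶ T.span => PROP.onArrows k x)
        T.ofPermHom.monadHom.π_multHom
    rw [h, PROP.mult_eq_seq]
    exact PROP.Ar.isComp_seq (PROP.tgt_fst x)
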